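/- Let $p$ be a prime, let $K$ be any field of characteristic $p$, let $n,k$ be positive integers with $\frac1n+\frac2k<1$, and let $\alpha_1,\dots,\alpha_k$ be distinct nonzero elements of $K$. Let $\mathbb P^1=\operatorname{Proj}K[X,Y]$ with function field $K(x)$, $x=X/Y$. For a divisor $D$ on $\mathbb P^1$ with rational coefficients let $[D]$ be the divisor obtained by rounding the coefficients down, and put $H^0(\mathbb P^1,\mathcal O(D))=\{f\in K(x): f=0 \text{ or } \operatorname{div}(f)+[D]\ge 0\}$. Let $$D=\sum_{i=1}^k \tfrac1n V(X-\alpha_iY),\qquad R=R(\mathbb P^1,D)=\bigoplus_{i\ge 0}H^0(\mathbb P^1,\mathcal O(iD))\,T^i\subseteq K(x)[T],$$ where the degree one element $T$ is also denoted by $Y$. Then: 1. $R$ is an $\mathbb N$-graded Noetherian normal domain of Krull dimension $2$ with $R_0=K$, generated as a $K$-algebra by $Y$ and the elements $A_i=\frac{x}{x-\alpha_i}Y^n$ $(1\le i\le k)$, and $Y$ is a nonzerodivisor, homogeneous of degree $1$. 2. There is a $K$-algebra isomorphism $R/YR\cong K[A_1,\dots,A_k]/(A_iA_j: i\ne j)$,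 taking the class of each $A_i$ to the class of the variable $A_i$, and the ring $R/YR$ is F-pure. 3. $R$ is not F-pure. 4. $R$ is F-rational, i.e. every parameter ideal of $R$ is tightly closed. Consequently, for every prime $p$, F-purity does not deform for normal graded domains of characteristic $p$: it is not true that, whenever $R$ is an $\mathbb N$-graded Noetherian normal domain with $R_0$ a field of characteristic $p$ and $x\in R$ is a homogeneous nonzerodivisor of positive degree with $R/xR$ F-pure, the ring $R$ is F-pure. Here a ring $S$ of characteristic $p$ is F-pure if for every $S$-module $M$ the Frobenius map $M\to S'\otimes_S M$, $m\mapsto 1\otimes m$, is injective, where $S'$ is $S$ viewed as an $S$-algebra via $s\mapsto s^p$; an ideal $I=(x_1,\dots,x_r)$ is a parameter ideal if the images of $x_1,\dots,x_r$ form part of a system of parameters of $R_P$ for every prime $P\supseteq I$. -/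

import Mathlib

open scoped TensorProduct Polynomial

universe u

/-! ### F-purity -/

/-- The ring `R`, regarded as an `R`-algebra through the Frobenius endomorphism `r ↦ r ^ p`. -/
def FrobeniusAlg (_p : ℕ) (R : Type*) : Type _ := R

instance FrobeniusAlg.instCommRing (p : ℕ) (R : Type*) [CommRing R] :
    CommRing (FrobeniusAlg p R) :=
  inferInstanceAs (CommRing R)

instance FrobeniusAlg.instAlgebra (p : ℕ) (R : Type*) [CommRing R] [ExpChar R p] :
    Algebra R (FrobeniusAlg p R) :=
  (frobenius R p).toAlgebra

/-- A ring `R` of characteristic `p` is F-pure if for every `R`-module `M` the Frobenius map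
`M → F(M) = S ⊗[R] M`, `m ↦ 1 ⊗ m`, is injective, where `S` is `R` viewed as an `R`-algebra via
Frobenius. -/
def IsFPure (p : ℕ) (R : Type u) [CommRing R] [ExpChar R p] : Prop :=
  ∀ (M : Type u) [AddCommGroup M] [Module R M],
    Function.Injective (fun m : M => (1 : FrobeniusAlg p R) ⊗ₜ[R] m)

/-! ### Tight closure, parameter ideals, F-rationality -/

/-- `x ∈ I^*`: there is `c` outside every minimal prime with `c x^q ∈ I^{[q]}` for all
`q = p^e ≫ 0`. Here `I^{[q]}` is the ideal generated by the image of `I` under `F^e`. -/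
def MemTightClosure (p : ℕ) {R : Type*} [CommRing R] [ExpChar R p] (I : Ideal R) (x : R) : Prop :=
  ∃ c : R, (∀ P ∈ minimalPrimes R, c ∉ P) ∧
    ∃ e₀ : ℕ, ∀ e ≥ e₀, c * x ^ p ^ e ∈ I.map (iterateFrobenius R p e)

/-- `I^* = I` (the inclusion `I ⊆ I^*` always holds). -/
def IsTightlyClosed (p : ℕ) {R : Type*} [CommRing R] [ExpChar R p] (I : Ideal R) : Prop :=
  ∀ x : R, MemTightClosure p I x ↔ x ∈ I

/-- `y` is a (full) system of parameters of the Noetherian local ring `A`: it has `dim A`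
entries, and the maximal ideal is the radical of the ideal they generate. -/
def IsSystemOfParameters {A : Type*} [CommRing A] [IsLocalRing A] {d : ℕ} (y : Fin d → A) : Prop :=
  ringKrullDim A = d ∧ (Ideal.span (Set.range y)).radical = IsLocalRing.maximalIdeal A

/-- `x` can be completed to a system of parameters. -/
def IsPartOfSystemOfParameters {A : Type*} [CommRing A] [IsLocalRing A] {r : ℕ}
    (x : Fin r → A) : Prop :=
  ∃ (s : ℕ) (z : Fin s → A), IsSystemOfParameters (Fin.append x z)

/-- `I = (x₁, …, x_r)` where the images of the `xᵢ` form part of a system of parameters in `R_P`,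
for every prime `P ⊇ I`. -/
def IsParameterIdeal {R : Type*} [CommRing R] (I : Ideal R) : Prop :=
  ∃ (r : ℕ) (x : Fin r → R), I = Ideal.span (Set.range x) ∧
    ∀ (P : Ideal R) [P.IsPrime], I ≤ P →
      IsPartOfSystemOfParameters (fun i => algebraMap R (Localization.AtPrime P) (x i))

/-- Every parameter ideal is tightly closed. -/
def IsFRational (p : ℕ) (R : Type*) [CommRing R] [ExpChar R p] : Prop :=
  ∀ I : Ideal R, IsParameterIdeal I → IsTightlyClosed p I

/-! ### Rational coefficient Weil divisors on the projective line

`ℙ¹ = Proj K[X, Y]` is used through the affine coordinate `x = X / Y`: its function field is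
`K(x)`, and its prime divisors (the closed points) are the closed points of the affine line
`Spec K[x]`, together with the point at infinity `V(Y)`. -/

namespace ProjLine

open IsDedekindDomain

/-- The prime divisors (codimension one irreducible subvarieties) of `ℙ¹` over `K`. -/
inductive PrimeDivisor (K : Type u) [Field K] : Type u
  | finite (v : HeightOneSpectrum K[X]) : PrimeDivisor K
  | infinity : PrimeDivisor K

/-- The coefficient of `div f` at a prime divisor, i.e. the order of vanishing of the rational
function `f` there. (The value at `f = 0` is irrelevant.) -/
noncomputable def ord {K : Type u} [Field K] (f : RatFunc K) : PrimeDivisor K → ℤ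
  | .finite v => -(WithZero.log (v.valuation (RatFunc K) f))
  | .infinity => -f.intDegree

/-- Rational coefficient Weil divisors on `ℙ¹`. -/
abbrev QDivisor (K : Type u) [Field K] : Type u := PrimeDivisor K →₀ ℚ

/-- The subvariety `V(X - αY)`, i.e. the point `x = α`. -/
noncomputable def point {K : Type u} [Field K] (α : K) : PrimeDivisor K :=
  .finite
    { asIdeal := Ideal.span {Polynomial.X - Polynomial.C α}
      isPrime := (Ideal.span_singleton_prime (Polynomial.X_sub_C_ne_zero α)).2
        (Polynomial.prime_X_sub_C α)
      ne_bot := by simpa using Polynomial.X_sub_C_ne_zero α }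

section

variable {K : Type u} [Field K]

theorem ord_mul {f g : RatFunc K} (hf : f ≠ 0) (hg : g ≠ 0) (P : PrimeDivisor K) :
    ord (f * g) P = ord f P + ord g P := by
  cases P with
  | finite v =>
    have h1 : v.valuation (RatFunc K) f ≠ 0 := (Valuation.ne_zero_iff _).2 hf
    have h2 : v.valuation (RatFunc K) g ≠ 0 := (Valuation.ne_zero_iff _).2 hg
    simp only [ord, map_mul, WithZero.log_mul h1 h2]
    ring
  | infinity =>
    simp only [ord, RatFunc.intDegree_mul hf hg]
    ring

theorem min_ord_le_ord_add {f g : RatFunc K} (hf : f ≠ 0) (hg : g ≠ 0) (hfg : f + g ≠ 0)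
    (P : PrimeDivisor K) : min (ord f P) (ord g P) ≤ ord (f + g) P := by
  cases P with
  | finite v =>
    have h1 : v.valuation (RatFunc K) f ≠ 0 := (Valuation.ne_zero_iff _).2 hf
    have h2 : v.valuation (RatFunc K) g ≠ 0 := (Valuation.ne_zero_iff _).2 hg
    have h3 : v.valuation (RatFunc K) (f + g) ≠ 0 := (Valuation.ne_zero_iff _).2 hfg
    simp only [ord, min_le_iff, neg_le_neg_iff]
    rcases le_max_iff.1 ((v.valuation (RatFunc K)).map_add f g) with h | h
    · exact Or.inl ((WithZero.log_le_log h3 h1).2 h)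
    · exact Or.inr ((WithZero.log_le_log h3 h2).2 h)
  | infinity =>
    have := RatFunc.intDegree_add_le hg hfg
    simp only [ord, min_le_iff, neg_le_neg_iff]
    rcases le_max_iff.1 this with h | h
    · exact Or.inl h
    · exact Or.inr h

theorem ord_algebraMap {c : K} (hc : c ≠ 0) (P : PrimeDivisor K) :
    ord (algebraMap K (RatFunc K) c) P = 0 := by
  have hC : algebraMap K (RatFunc K) c =
      algebraMap K[X] (RatFunc K) (Polynomial.C c) := by
    rw [IsScalarTower.algebraMap_apply K K[X] (RatFunc K), Polynomial.algebraMap_eq]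
  cases P with
  | finite v =>
    have h : v.valuation (RatFunc K) (algebraMap K (RatFunc K) c) = 1 := by
      rw [hC, HeightOneSpectrum.valuation_eq_one_iff_notMem]
      intro hmem
      exact v.isPrime.ne_top
        (Ideal.eq_top_of_isUnit_mem _ hmem (Polynomial.isUnit_C.2 hc.isUnit))
    simp only [ord, h, WithZero.log_one, neg_zero]
  | infinity =>
    simp [ord]

/-- `H⁰(ℙ¹, 𝒪(D)) = {f ∈ K(ℙ¹) : div f + [D] ≥ 0}` for a rational coefficient Weil divisor `D`,
where `[D]` is obtained by rounding down the coefficients, and the zero function is included. -/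
noncomputable def sections (D : QDivisor K) : Submodule K (RatFunc K) where
  carrier := {f | f = 0 ∨ ∀ P, 0 ≤ ord f P + ⌊D P⌋}
  zero_mem' := Or.inl rfl
  add_mem' := by
    rintro f g hf hg
    by_cases hf0 : f = 0
    · simpa [hf0] using hg
    by_cases hg0 : g = 0
    · simpa [hg0] using hf
    by_cases hfg : f + g = 0
    · exact Or.inl hfg
    refine Or.inr fun P => ?_
    have h1 := hf.resolve_left hf0 P
    have h2 := hg.resolve_left hg0 P
    rcases min_le_iff.1 (min_ord_le_ord_add hf0 hg0 hfg P) with h | h <;> omega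
  smul_mem' := by
    rintro c f hf
    by_cases hc : c = 0
    · exact Or.inl (by simp [hc])
    by_cases hf0 : f = 0
    · exact Or.inl (by simp [hf0])
    refine Or.inr fun P => ?_
    have hc' : algebraMap K (RatFunc K) c ≠ 0 := by simpa using hc
    rw [Algebra.smul_def, ord_mul hc' hf0, ord_algebraMap hc, zero_add]
    exact hf.resolve_left hf0 P

theorem mul_mem_sections {D E : QDivisor K} {f g : RatFunc K} (hf : f ∈ sections D)
    (hg : g ∈ sections E) : f * g ∈ sections (D + E) := by
  by_cases hf0 : f = 0
  · exact Or.inl (by simp [hf0])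
  by_cases hg0 : g = 0
  · exact Or.inl (by simp [hg0])
  refine Or.inr fun P => ?_
  have h1 := hf.resolve_left hf0 P
  have h2 := hg.resolve_left hg0 P
  have h3 : ⌊D P⌋ + ⌊E P⌋ ≤ ⌊(D + E) P⌋ := by
    rw [Finsupp.add_apply]
    exact Int.le_floor_add _ _
  rw [ord_mul hf0 hg0]
  omega

theorem algebraMap_mem_sections_zero (c : K) :
    algebraMap K (RatFunc K) c ∈ sections (0 : QDivisor K) := by
  by_cases hc : c = 0
  · exact Or.inl (by simp [hc])
  · exact Or.inr fun P => by rw [ord_algebraMap hc]; simp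

/-- Demazure's graded ring `R(ℙ¹, D) = ⨁_{i ≥ 0} H⁰(ℙ¹, 𝒪(iD)) Tⁱ ⊆ K(ℙ¹)[T]`. -/
noncomputable def sectionRing (D : QDivisor K) : Subalgebra K (RatFunc K)[X] where
  carrier := {F | ∀ i : ℕ, F.coeff i ∈ sections (i • D)}
  add_mem' := by
    intro F G hF hG i
    rw [Polynomial.coeff_add]
    exact add_mem (hF i) (hG i)
  mul_mem' := by
    intro F G hF hG i
    rw [Polynomial.coeff_mul]
    refine Submodule.sum_mem _ fun a ha => ?_
    rw [← Finset.HasAntidiagonal.mem_antidiagonal.1 ha, add_smul]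
    exact mul_mem_sections (hF a.1) (hG a.2)
  algebraMap_mem' := by
    intro c i
    rw [Polynomial.algebraMap_apply, Polynomial.coeff_C]
    split_ifs with h
    · rw [h, zero_smul]
      exact algebraMap_mem_sections_zero c
    · exact zero_mem _

/-- The degree `i` part `H⁰(ℙ¹, 𝒪(iD)) Tⁱ` of `R(ℙ¹, D)`. -/
noncomputable def sectionRingGrading (D : QDivisor K) (i : ℕ) : Submodule K (sectionRing D) where
  carrier := {F | ∀ j : ℕ, j ≠ i → (F : (RatFunc K)[X]).coeff j = 0}
  zero_mem' := by
    intro j _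
    simp
  add_mem' := by
    intro F G hF hG j hj
    simp [hF j hj, hG j hj]
  smul_mem' := by
    intro c F hF j hj
    simp [hF j hj]

instance sectionRing.instCharP (D : QDivisor K) (p : ℕ) [CharP K p] : CharP (sectionRing D) p :=
  charP_of_injective_algebraMap (algebraMap K (sectionRing D)).injective p

end

/-- The divisor `(1/n) V(X - α₁Y) + ⋯ + (1/n) V(X - α_kY)`. -/
noncomputable def fractionalPoints {K : Type u} [Field K] (n : ℕ) {k : ℕ} (α : Fin k → K) :
    QDivisor K :=
  ∑ i, Finsupp.single (point (α i)) (1 / (n : ℚ))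

end ProjLine

/-! ### Deformation of F-purity -/

/-- F-purity deforms for normal graded domains of characteristic `p`: if `R` is a Noetherian normal
domain, graded by `ℕ` with `R₀ = K` a field of characteristic `p`, and `x` is a homogeneous
nonzerodivisor of positive degree such that `R/xR` is F-pure, then `R` is F-pure. -/
def FPurityDeformsForNormalGradedDomains (p : ℕ) [Fact p.Prime] : Prop :=
  ∀ (K R : Type u) [Field K] [CharP K p] [CommRing R] [IsDomain R] [IsNoetherianRing R]
    [IsIntegrallyClosed R] [Algebra K R] [CharP R p]
    (𝒜 : ℕ → Submodule K R) [GradedAlgebra 𝒜], 𝒜 0 = 1 →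
    ∀ (x : R) [CharP (R ⧸ Ideal.span {x}) p], x ∈ nonZeroDivisors R →
      (∃ i : ℕ, 0 < i ∧ x ∈ 𝒜 i) →
      IsFPure p (R ⧸ Ideal.span {x}) → IsFPure p R

/-!
Write `g = ∏ (x - αⱼ)`. Since `i D` rounds down to `⌊i / n⌋ ∑ Pⱼ`, the degree `i` part of
`R = R(ℙ¹, D)` consists of the `(f / g ^ ⌊i / n⌋) Tⁱ` with `deg f ≤ k ⌊i / n⌋`
(`ProjLine.mem_sections_iff`). This turns every assertion into one about polynomials in `x`.

*Structure of `R`.* Let `Y = T` and `h = Tⁿ / g`. Interpolating the numerators at the `αⱼ` writes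
every element of degree `n m` as a combination of the `A j ^ m` plus a multiple of `Yⁿ`. Hence `Y`
and the `A j` generate `R`, and `R / YR`, in which `A i A j = 0` for `i ≠ j`, is the coordinate ring
of `k` coordinate axes (`ProjLine.quotientEquiv`). Expanding numerators in base `g` shows that `R`
is finite over `K[Y, h]`, so its dimension is at most two; it is at least two because `R / YR` maps
onto `K[t]`. Membership in a section ring is a condition on orders that can be tested after dividing
by a large exponent, so section rings contain the elements of `K(x)[T]` that are almost integral
over them, and are therefore normal.

*`R / YR` is F-pure.* The map `∑ cₘ xᵐ ↦ ∑ μ(c_{pm}) xᵐ`, with `μ` a splitting of the Frobenius of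
`K`, splits the Frobenius of the polynomial ring and preserves the monomial ideal `(A i A j)`.

*`R` is not F-pure* (`ProjLine.not_isFPure_fracRing`). The condition `1 / n + 2 / k < 1` says that
`K_{ℙ¹} + ∑ (1 - 1 / n) Pⱼ` has positive degree. If `ω` is the ideal generated by the
`(xᵃ / g) Tⁿ`, `a ≤ k - 2`, and `J = (Y ^ (n + 1), h) ω`, then `z = Yⁿ x ^ (k - 1) h²` is not in
`J`, but `z ^ p` is in `J^{[p]}`. So Frobenius is not injective on `R / J`.

*`R` is F-rational* (`ProjLine.isFRational_fracRing`). By the definition of parameters, an ideal of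
parameters has at most two generators. Principal ideals of a Noetherian normal domain are tightly
closed. In the remaining case the quotient by `(x, y)` is finite over `K`, so `(x, y)` contains
monic polynomials `u` in `Y` and `v` in `h`, and four reductions lead to the ideal `(Y, h)`:

* multiplication by the determinant of the matrix expressing `u, v` through `x, y` carries the tight
  closure of `(x, y)` into that of `(u, v)`, and what it carries into `(u, v)` lies in `(x, y)`
  (`TightPair.of_regularPair`);
* the leading forms of `u` and `v` are a regular pair of powers of `Y` and `h`, so `(u, v)` may be
  replaced by the ideal they generate (`TightPair.of_lead`);
* an ideal generated by powers of a regular pair is tightly closed if the pair itself generates a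
  tightly closed ideal (`TightPair.pow`);
* `R / (Y, h)` vanishes outside the degrees `0` and `n`, and in degree `n` the condition
  `c z ^ q ∈ (Y ^ q, h ^ q)` reads `Γ f ^ q ≡ S` modulo a high power of `g`, where `f` is the
  numerator of `z` and `Γ`, `S` have bounded degree. As `f ^ q` is congruent to the constant
  `f(αⱼ) ^ q` modulo `(x - αⱼ) ^ q`, the values `f(αⱼ)` are all equal. Thus `f` is a combination of
  `1` and `g`, that is, `z` is a combination of `h` and `Yⁿ` (`ProjLine.tightPair_elemY_elemH`).

For the failure of deformation, take `n = 4`, `k = 3` and an infinite field of characteristic `p`.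
-/

namespace ProjLine

open IsDedekindDomain Polynomial

variable {K : Type u} [Field K] {k : ℕ}

/-! ### The sections of the multiples of the divisor -/

/-- The polynomial `g = ∏ (x - αᵢ)`, a local equation of the divisor `∑ Pᵢ`. -/
noncomputable abbrev locEq (α : Fin k → K) : K[X] := Lagrange.nodal Finset.univ α

lemma locEq_monic (α : Fin k → K) : (locEq α).Monic := Lagrange.nodal_monic

lemma natDegree_locEq (α : Fin k → K) : (locEq α).natDegree = k := by
  simp [locEq, Lagrange.natDegree_nodal]

lemma natDegree_locEq_pow (α : Fin k → K) (m : ℕ) : (locEq α ^ m).natDegree = k * m := by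
  rw [(locEq_monic α).natDegree_pow, natDegree_locEq, mul_comm]

lemma eval_locEq (α : Fin k → K) (j : Fin k) : (locEq α).eval (α j) = 0 :=
  Lagrange.eval_nodal_at_node (Finset.mem_univ j)

lemma X_sub_C_dvd_locEq (α : Fin k → K) (j : Fin k) : X - C (α j) ∣ locEq α :=
  Lagrange.X_sub_C_dvd_nodal _ (Finset.mem_univ j)

/-- A polynomial vanishing at all the (distinct) `αᵢ` is divisible by `g`. -/
lemma locEq_dvd_of_eval_eq_zero {α : Fin k → K} (hα : Function.Injective α) {f : K[X]}
    (hf : ∀ j, f.eval (α j) = 0) : locEq α ∣ f := by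
  rw [locEq, Lagrange.nodal_eq]
  refine Finset.prod_dvd_of_coprime (fun i _ j _ hij => ?_) fun i _ => dvd_iff_isRoot.2 (hf i)
  exact pairwise_coprime_X_sub_C hα hij

lemma algebraMap_locEq_ne_zero (α : Fin k → K) : algebraMap K[X] (RatFunc K) (locEq α) ≠ 0 := by
  simpa using (locEq_monic α).ne_zero

lemma point_eq_finite_iff {a : K} {v : HeightOneSpectrum K[X]} :
    point a = .finite v ↔ X - C a ∈ v.asIdeal := by
  constructor
  · intro h
    rw [point, PrimeDivisor.finite.injEq] at h
    rw [← h]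
    exact Ideal.mem_span_singleton_self _
  · intro h
    rw [point, PrimeDivisor.finite.injEq]
    have hmax : (Ideal.span {X - C a}).IsMaximal :=
      PrincipalIdealRing.isMaximal_of_irreducible (irreducible_X_sub_C a)
    ext1
    exact hmax.eq_of_le v.isPrime.ne_top (by simpa [Ideal.span_le] using h)

lemma point_injective : Function.Injective (point : K → PrimeDivisor K) := by
  intro a b h
  have h1 : X - C a ∈ Ideal.span {X - C b} := by
    have := point_eq_finite_iff.1 (h.trans rfl)
    exact this
  have h2 := dvd_iff_isRoot.1 (Ideal.mem_span_singleton.1 h1)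
  simpa [sub_eq_zero, eq_comm] using h2

lemma exists_mem_of_locEq_mem {α : Fin k → K} {v : HeightOneSpectrum K[X]}
    (h : locEq α ∈ v.asIdeal) : ∃ j, point (α j) = .finite v := by
  rw [locEq, Lagrange.nodal_eq] at h
  obtain ⟨j, -, hj⟩ := (Ideal.IsPrime.prod_mem_iff (hp := v.isPrime)).1 h
  exact ⟨j, point_eq_finite_iff.2 hj⟩

lemma ord_locEq_of_point {α : Fin k → K} (hα : Function.Injective α) (j : Fin k) :
    ord (algebraMap K[X] (RatFunc K) (locEq α)) (point (α j)) = 1 := by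
  classical
  have h0 : X - C (α j) ≠ 0 := X_sub_C_ne_zero _
  have hfac := Lagrange.nodal_eq_mul_nodal_erase (v := α) (Finset.mem_univ j)
  have hr : Lagrange.nodal (Finset.univ.erase j) α ≠ 0 := Lagrange.nodal_ne_zero
  have inj := IsFractionRing.injective K[X] (RatFunc K)
  rw [locEq, hfac, map_mul,
    ord_mul ((map_ne_zero_iff _ inj).2 h0) ((map_ne_zero_iff _ inj).2 hr)]
  have e1 : ord (algebraMap K[X] (RatFunc K) (X - C (α j))) (point (α j)) = 1 := by
    rw [point]
    simp only [ord]
    rw [HeightOneSpectrum.valuation_of_algebraMap,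
      HeightOneSpectrum.intValuation_singleton _ h0 rfl]
    simp
  have e2 : ord (algebraMap K[X] (RatFunc K) (Lagrange.nodal (Finset.univ.erase j) α))
      (point (α j)) = 0 := by
    rw [point]
    simp only [ord]
    rw [HeightOneSpectrum.valuation_eq_one_iff_notMem _ |>.2, WithZero.log_one, neg_zero]
    intro hmem
    have := dvd_iff_isRoot.1 (Ideal.mem_span_singleton.1 hmem)
    rw [IsRoot, Lagrange.eval_nodal, Finset.prod_eq_zero_iff] at this
    obtain ⟨i, hi, h⟩ := this
    exact (Finset.ne_of_mem_erase hi) (hα (sub_eq_zero.1 h)).symm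
  rw [e1, e2, add_zero]

lemma ord_locEq_of_forall_ne {α : Fin k → K} {v : HeightOneSpectrum K[X]}
    (h : ∀ j, point (α j) ≠ .finite v) :
    ord (algebraMap K[X] (RatFunc K) (locEq α)) (.finite v) = 0 := by
  simp only [ord]
  rw [HeightOneSpectrum.valuation_eq_one_iff_notMem _ |>.2, WithZero.log_one, neg_zero]
  intro hmem
  obtain ⟨j, hj⟩ := exists_mem_of_locEq_mem hmem
  exact h j hj

lemma fractionalPoints_point (n : ℕ) {α : Fin k → K} (hα : Function.Injective α) (j : Fin k) :
    fractionalPoints n α (point (α j)) = 1 / (n : ℚ) := by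
  rw [fractionalPoints, Finsupp.finsetSum_apply, Finset.sum_eq_single j]
  · simp
  · intro i _ hij
    exact Finsupp.single_eq_of_ne fun h => hij (hα (point_injective h.symm))
  · simp

lemma fractionalPoints_of_forall_ne (n : ℕ) {α : Fin k → K} {P : PrimeDivisor K}
    (h : ∀ j, point (α j) ≠ P) : fractionalPoints n α P = 0 := by
  rw [fractionalPoints, Finsupp.finsetSum_apply]
  exact Finset.sum_eq_zero fun i _ => Finsupp.single_eq_of_ne fun h' => h i h'.symm

lemma floor_smul_fractionalPoints_point (n : ℕ) {α : Fin k → K} (hα : Function.Injective α)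
    (i : ℕ) (j : Fin k) : ⌊(i • fractionalPoints n α) (point (α j))⌋ = (i / n : ℕ) := by
  rw [Finsupp.smul_apply, fractionalPoints_point n hα, nsmul_eq_mul, mul_one_div]
  exact Rat.floor_natCast_div_natCast i n

lemma ord_finite_nonneg_iff {φ : RatFunc K} (h0 : φ ≠ 0) :
    (∀ v, 0 ≤ ord φ (.finite v)) ↔ ∃ f : K[X], φ = algebraMap K[X] (RatFunc K) f := by
  have key : ∀ v : HeightOneSpectrum K[X],
      0 ≤ ord φ (.finite v) ↔ v.valuation (RatFunc K) φ ≤ 1 := by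
    intro v
    have h1 : v.valuation (RatFunc K) φ ≠ 0 := (Valuation.ne_zero_iff _).2 h0
    simp only [ord]
    rw [neg_nonneg, ← WithZero.log_one, WithZero.log_le_log h1 one_ne_zero]
  constructor
  · intro h
    obtain ⟨f, hf⟩ := HeightOneSpectrum.mem_integers_of_valuation_le_one (R := K[X]) (RatFunc K) φ
      fun v => (key v).1 (h v)
    exact ⟨f, hf.symm⟩
  · rintro ⟨f, rfl⟩ v
    exact (key v).2 (v.valuation_le_one f)

lemma ord_pow {φ : RatFunc K} (h0 : φ ≠ 0) (m : ℕ) (P : PrimeDivisor K) :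
    ord (φ ^ m) P = m * ord φ P := by
  induction m with
  | zero => simpa using ord_algebraMap (one_ne_zero : (1 : K) ≠ 0) P
  | succ m ih => rw [pow_succ, ord_mul (pow_ne_zero _ h0) h0, ih]; push_cast; ring

/-- `H⁰(ℙ¹, 𝒪(iD))` consists of the fractions `f / g ^ ⌊i / n⌋` with `deg f ≤ k ⌊i / n⌋`. -/
theorem mem_sections_iff (n : ℕ) {α : Fin k → K} (hα : Function.Injective α)
    (i : ℕ) (φ : RatFunc K) :
    φ ∈ sections (i • fractionalPoints n α) ↔ ∃ f : K[X], f.natDegree ≤ k * (i / n) ∧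
      φ = algebraMap K[X] (RatFunc K) f / algebraMap K[X] (RatFunc K) (locEq α) ^ (i / n) := by
  have hg := algebraMap_locEq_ne_zero α
  have hgm := pow_ne_zero (i / n) hg
  set G := algebraMap K[X] (RatFunc K) (locEq α) with hG
  by_cases h0 : φ = 0
  · refine ⟨fun _ => ⟨0, by simp, by simp [h0]⟩, fun _ => Or.inl h0⟩
  have hdeg : ∀ f : K[X], φ = algebraMap K[X] (RatFunc K) f / G ^ (i / n) →
      φ.intDegree = f.natDegree - k * (i / n : ℕ) := by
    intro f hf
    have hf0 : algebraMap K[X] (RatFunc K) f ≠ 0 := by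
      rintro h
      rw [h, zero_div] at hf
      exact h0 hf
    rw [hf, RatFunc.intDegree_div hf0 hgm, hG, ← map_pow, RatFunc.intDegree_polynomial,
      RatFunc.intDegree_polynomial, natDegree_locEq_pow]
    push_cast
    ring
  have hfin : (∀ v, 0 ≤ ord φ (.finite v) + ⌊(i • fractionalPoints n α) (.finite v)⌋) ↔
      ∀ v, 0 ≤ ord (φ * G ^ (i / n)) (.finite v) := by
    refine forall_congr' fun v => ?_
    rw [ord_mul h0 hgm, ord_pow hg]
    by_cases hv : ∃ j, point (α j) = .finite v
    · obtain ⟨j, hj⟩ := hv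
      rw [← hj, floor_smul_fractionalPoints_point n hα, ord_locEq_of_point hα, mul_one]
    · push Not at hv
      rw [ord_locEq_of_forall_ne hv, Finsupp.smul_apply, fractionalPoints_of_forall_ne n hv]
      simp
  have hinf : 0 ≤ ord φ .infinity + ⌊(i • fractionalPoints n α) .infinity⌋ ↔ φ.intDegree ≤ 0 := by
    rw [Finsupp.smul_apply, fractionalPoints_of_forall_ne n (fun j => by simp [point])]
    simp [ord]
  have hsec : φ ∈ sections (i • fractionalPoints n α) ↔
      (∀ v, 0 ≤ ord (φ * G ^ (i / n)) (.finite v)) ∧ φ.intDegree ≤ 0 := by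
    rw [← hfin, ← hinf]
    constructor
    · intro h
      have h := h.resolve_left h0
      exact ⟨fun v => h _, h _⟩
    · rintro ⟨h1, h2⟩
      refine Or.inr fun P => ?_
      cases P with
      | finite v => exact h1 v
      | infinity => exact h2
  rw [hsec, ord_finite_nonneg_iff (mul_ne_zero h0 hgm)]
  constructor
  · rintro ⟨⟨f, hf⟩, hd⟩
    have hf' := eq_div_of_mul_eq hgm hf
    refine ⟨f, ?_, hf'⟩
    have := hdeg f hf'
    zify
    push_cast at this
    omega
  · rintro ⟨f, hd, hf⟩
    refine ⟨⟨f, by rw [hf, div_mul_cancel₀ _ hgm]⟩, ?_⟩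
    rw [hdeg f hf]
    zify at hd
    push_cast
    omega

end ProjLine

namespace ProjLine

open IsDedekindDomain Polynomial

variable {K : Type u} [Field K]

/-! ### The grading and normality of a section ring -/

/-- The homogeneous component of degree `i`. -/
noncomputable def component (D : QDivisor K) (i : ℕ) : sectionRing D →ₗ[K] sectionRing D where
  toFun F := ⟨monomial i ((F : (RatFunc K)[X]).coeff i), fun j => by
    rw [coeff_monomial]
    split_ifs with h
    · exact h ▸ F.2 i
    · exact zero_mem _⟩
  map_add' F G := Subtype.ext (by
    change monomial i ((F + G : (RatFunc K)[X]).coeff i) = monomial i _ + monomial i _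
    rw [coeff_add, map_add])
  map_smul' c F := Subtype.ext (by
    change monomial i ((c • (F : (RatFunc K)[X])).coeff i) = c • monomial i _
    rw [coeff_smul, smul_monomial])

lemma coe_component (D : QDivisor K) (i : ℕ) (F : sectionRing D) :
    (component D i F : (RatFunc K)[X]) = monomial i ((F : (RatFunc K)[X]).coeff i) := rfl

lemma component_mem (D : QDivisor K) (i : ℕ) (F : sectionRing D) :
    component D i F ∈ sectionRingGrading D i := fun j hj => by
  rw [coe_component, coeff_monomial, if_neg hj.symm]

lemma component_of_mem {D : QDivisor K} {i : ℕ} {F : sectionRing D}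
    (h : F ∈ sectionRingGrading D i) : component D i F = F := by
  refine Subtype.ext (Polynomial.ext fun j => ?_)
  rw [coe_component, coeff_monomial]
  split_ifs with hj
  · rw [hj]
  · exact (h j (Ne.symm hj)).symm

lemma component_of_mem_ne {D : QDivisor K} {i j : ℕ} {F : sectionRing D}
    (h : F ∈ sectionRingGrading D i) (hij : j ≠ i) : component D j F = 0 :=
  Subtype.ext (by rw [coe_component, h j hij, monomial_zero_right]; rfl)

lemma sum_component (D : QDivisor K) (F : sectionRing D) :
    ∑ i ∈ (F : (RatFunc K)[X]).support, component D i F = F := by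
  refine Subtype.ext ?_
  rw [AddSubmonoidClass.coe_finsetSum]
  exact (as_sum_support (F : (RatFunc K)[X])).symm

lemma coeff_coeAddMonoidHom (D : QDivisor K) (j : ℕ)
    (x : DirectSum ℕ fun i => sectionRingGrading D i) :
    (DirectSum.coeAddMonoidHom (sectionRingGrading D) x : (RatFunc K)[X]).coeff j =
      ((x j : sectionRing D) : (RatFunc K)[X]).coeff j := by
  induction x using DirectSum.induction_on with
  | zero => rw [map_zero]; rfl
  | of i F =>
    rw [DirectSum.coeAddMonoidHom_of]
    by_cases hij : j = i
    · subst hij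
      rw [DirectSum.of_eq_same]
    · rw [DirectSum.of_eq_of_ne _ _ _ hij, F.2 j hij]
      rfl
  | add x y hx hy =>
    rw [map_add, AddMemClass.coe_add, coeff_add, hx, hy, DirectSum.add_apply, Submodule.coe_add,
      AddMemClass.coe_add, coeff_add]

/-- The homogeneous components of an element, as an element of the direct sum. -/
noncomputable def toDirectSum (D : QDivisor K) (F : sectionRing D) :
    DirectSum ℕ fun i => sectionRingGrading D i :=
  DirectSum.mk _ (F : (RatFunc K)[X]).support fun i => ⟨component D i F, component_mem D i F⟩

lemma coe_toDirectSum_apply (D : QDivisor K) (F : sectionRing D) (i : ℕ) :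
    (toDirectSum D F i : sectionRing D) = component D i F := by
  by_cases h : i ∈ (F : (RatFunc K)[X]).support
  · rw [toDirectSum, DirectSum.mk_apply_of_mem h]
  · rw [toDirectSum, DirectSum.mk_apply_of_notMem h]
    rw [notMem_support_iff] at h
    exact Subtype.ext (by rw [coe_component, h, monomial_zero_right]; rfl)

noncomputable instance sectionRingGrading.instGradedAlgebra (D : QDivisor K) :
    GradedAlgebra (sectionRingGrading D) where
  one_mem := fun j hj => by
    rw [OneMemClass.coe_one, coeff_one, if_neg hj]
  mul_mem := by
    intro i j F G hF hG
    rw [← component_of_mem hF, ← component_of_mem hG]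
    intro l hl
    rw [MulMemClass.coe_mul, coe_component, coe_component, monomial_mul_monomial,
      coeff_monomial, if_neg hl.symm]
  toDecomposition := DirectSum.Decomposition.ofAddHom _
    { toFun := toDirectSum D
      map_zero' := DFinsupp.ext fun i => Subtype.ext (by
        rw [coe_toDirectSum_apply, map_zero]; rfl)
      map_add' := fun F G => DFinsupp.ext fun i => Subtype.ext (by
        rw [coe_toDirectSum_apply, map_add, DirectSum.add_apply, Submodule.coe_add,
          coe_toDirectSum_apply, coe_toDirectSum_apply]) }
    (by
      ext1 F
      change DirectSum.coeAddMonoidHom _ (toDirectSum D F) = F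
      refine Subtype.ext (Polynomial.ext fun j => ?_)
      rw [coeff_coeAddMonoidHom, coe_toDirectSum_apply, coe_component, coeff_monomial_same])
    (by
      ext i F j : 3
      change (toDirectSum D (DirectSum.coeAddMonoidHom _ (DirectSum.of _ i F)) j) =
        (DirectSum.of (fun i => sectionRingGrading D i) i F j)
      refine Subtype.ext ?_
      rw [coe_toDirectSum_apply, DirectSum.coeAddMonoidHom_of]
      by_cases hij : j = i
      · subst hij
        rw [DirectSum.of_eq_same, component_of_mem F.2]
      · rw [DirectSum.of_eq_of_ne _ _ _ hij, component_of_mem_ne F.2 hij]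
        rfl)

lemma _root_.IsAlmostIntegral.sub_algebraMap {R S : Type*} [CommRing R] [CommRing S] [Algebra R S]
    {s : S} (h : IsAlmostIntegral R s) (r : R) : IsAlmostIntegral R (s - algebraMap R S r) :=
  sub_mem (mem_completeIntegralClosure.2 h) ((completeIntegralClosure R S).algebraMap_mem r)

/-- A subring `R` of an integrally closed domain `S` is integrally closed as soon as it contains
every element of `S` that is almost integral over it. -/
lemma _root_.IsIntegrallyClosed.of_isAlmostIntegral {R S : Type*} [CommRing R] [IsDomain R]
    [CommRing S] [IsDomain S] [IsIntegrallyClosed S] [Algebra R S]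
    (hinj : Function.Injective (algebraMap R S))
    (h : ∀ s : S, IsAlmostIntegral R s → ∃ r, algebraMap R S r = s) : IsIntegrallyClosed R := by
  refine (isIntegrallyClosed_iff (FractionRing R)).2 fun {x} hx => ?_
  have hinj2 : Function.Injective (algebraMap S (FractionRing S)) := IsFractionRing.injective _ _
  have hinj' : Function.Injective (algebraMap R (FractionRing S)) := by
    rw [IsScalarTower.algebraMap_eq R S (FractionRing S)]
    exact hinj2.comp hinj
  let ι : FractionRing R →ₐ[R] FractionRing S :=
    IsFractionRing.liftAlgHom (g := Algebra.ofId R (FractionRing S)) hinj'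
  have hι : Function.Injective ι := ι.toRingHom.injective
  -- the image of `x` in `Frac S` is integral over `S`, hence an element of `S`
  have hx' : IsIntegral S (ι x) := (hx.map ι).tower_top
  obtain ⟨F, hF⟩ := IsIntegrallyClosed.isIntegral_iff.1 hx'
  obtain ⟨r, hr⟩ : ∃ r, algebraMap R S r = F := by
    refine h F ?_
    obtain ⟨c, hc, hcx⟩ := hx.isAlmostIntegral
    refine ⟨c, hc, fun N => ?_⟩
    obtain ⟨r, hr⟩ := hcx N
    refine ⟨r, hinj2 ?_⟩
    have := congrArg ι hr
    rw [AlgHom.commutes, map_smul, map_pow, ← hF] at this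
    rw [← IsScalarTower.algebraMap_apply, this, Algebra.smul_def, Algebra.smul_def, map_mul,
      map_pow, ← IsScalarTower.algebraMap_apply]
  refine ⟨r, hι ?_⟩
  rw [AlgHom.commutes, ← hF, IsScalarTower.algebraMap_apply R S (FractionRing S), hr]

/-- A linear function of `N` that stays nonnegative has nonnegative slope; rounding down on both
sides makes no difference. -/
lemma floor_nonneg_of_forall_floor_nonneg {a b d e : ℤ} {w : ℚ}
    (h : ∀ N : ℕ, 0 ≤ a + N * b + ⌊(d + N * e : ℚ) * w⌋) : 0 ≤ b + ⌊e * w⌋ := by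
  have h' : ∀ N : ℕ, 0 ≤ (a + d * w) + N * (b + e * w : ℚ) := by
    intro N
    have h1 : (0 : ℚ) ≤ ((a + N * b + ⌊(d + N * e : ℚ) * w⌋ : ℤ) : ℚ) := by exact_mod_cast h N
    push_cast at h1
    have h2 := Int.floor_le ((d + N * e : ℚ) * w)
    linarith
  have h3 : (0 : ℚ) ≤ b + e * w := by
    by_contra! hneg
    obtain ⟨N, hN⟩ := exists_nat_gt ((a + d * w) / (-(b + e * w)))
    rw [div_lt_iff₀ (by linarith)] at hN
    have := h' N
    linarith
  have : -b ≤ ⌊e * w⌋ := Int.le_floor.2 (by push_cast; linarith)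
  omega

/-- The leading term of an element of `K(x)[T]` that is almost integral over the section ring lies
in the section ring: being a section is a condition on the order at each prime divisor. -/
lemma leadingTerm_mem_of_isAlmostIntegral {D : QDivisor K} {F : (RatFunc K)[X]}
    (h : IsAlmostIntegral (sectionRing D) F) :
    monomial F.natDegree F.leadingCoeff ∈ sectionRing D := by
  by_cases hF : F = 0
  · simp [hF]
  obtain ⟨c, hc, hcF⟩ := h
  have hc0 : (c : (RatFunc K)[X]) ≠ 0 := by
    simpa using nonZeroDivisors.ne_zero hc
  have hlF : F.leadingCoeff ≠ 0 := leadingCoeff_ne_zero.2 hF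
  have hlc : (c : (RatFunc K)[X]).leadingCoeff ≠ 0 := leadingCoeff_ne_zero.2 hc0
  have key : ∀ N : ℕ, ∀ P, 0 ≤ ord (c : (RatFunc K)[X]).leadingCoeff P + N * ord F.leadingCoeff P
      + ⌊(((c : (RatFunc K)[X]).natDegree : ℤ) + N * (F.natDegree : ℤ) : ℚ) * D P⌋ := by
    intro N P
    obtain ⟨G, hG⟩ := hcF N
    have hG' : (G : (RatFunc K)[X]) = c * F ^ N := hG
    have h1 := G.2 ((c : (RatFunc K)[X]).natDegree + N * F.natDegree)
    have h2 : (G : (RatFunc K)[X]).coeff ((c : (RatFunc K)[X]).natDegree + N * F.natDegree) =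
        (c : (RatFunc K)[X]).leadingCoeff * F.leadingCoeff ^ N := by
      rw [hG', ← natDegree_pow, coeff_mul_degree_add_degree, leadingCoeff_pow]
    rw [h2] at h1
    have h3 := h1.resolve_left (mul_ne_zero hlc (pow_ne_zero _ hlF)) P
    rw [ord_mul hlc (pow_ne_zero _ hlF), ord_pow hlF, Finsupp.smul_apply, nsmul_eq_mul] at h3
    push_cast at h3 ⊢
    exact h3
  intro j
  rw [coeff_monomial]
  split_ifs with hj
  · refine Or.inr fun P => ?_
    have := floor_nonneg_of_forall_floor_nonneg fun N => key N P
    rw [← hj, Finsupp.smul_apply, nsmul_eq_mul]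
    exact_mod_cast this
  · exact zero_mem _

lemma mem_of_isAlmostIntegral {D : QDivisor K} {F : (RatFunc K)[X]}
    (h : IsAlmostIntegral (sectionRing D) F) : F ∈ sectionRing D := by
  induction hd : F.natDegree using Nat.strong_induction_on generalizing F with
  | _ d ih =>
    have h1 := leadingTerm_mem_of_isAlmostIntegral h
    have h2 : IsAlmostIntegral (sectionRing D) F.eraseLead := by
      rw [← self_sub_monomial_natDegree_leadingCoeff]
      exact h.sub_algebraMap ⟨_, h1⟩
    rw [← eraseLead_add_monomial_natDegree_leadingCoeff F]
    refine add_mem ?_ h1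
    by_cases h0 : F.eraseLead = 0
    · rw [h0]; exact zero_mem _
    refine ih _ ?_ h2 rfl
    rw [← hd]
    refine lt_of_le_of_ne (eraseLead_natDegree_le_aux) fun heq => ?_
    have := leadingCoeff_ne_zero.2 h0
    rw [leadingCoeff, heq, eraseLead_coeff_natDegree] at this
    exact this rfl

instance sectionRing.instIsIntegrallyClosed (D : QDivisor K) :
    IsIntegrallyClosed (sectionRing D) :=
  .of_isAlmostIntegral (S := (RatFunc K)[X]) Subtype.val_injective fun F hF =>
    ⟨⟨F, mem_of_isAlmostIntegral hF⟩, rfl⟩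

end ProjLine

namespace ProjLine

open IsDedekindDomain Polynomial

variable {K : Type u} [Field K] {k : ℕ}

/-! ### Elements of the section ring -/

/-- The rational function `f / g ^ m`, where `g = ∏ (x - αᵢ)`. -/
noncomputable def frac (α : Fin k → K) (f : K[X]) (m : ℕ) : RatFunc K :=
  algebraMap K[X] (RatFunc K) f / algebraMap K[X] (RatFunc K) (locEq α) ^ m

section frac

variable (α : Fin k → K)

lemma frac_add (f f' : K[X]) (m : ℕ) : frac α (f + f') m = frac α f m + frac α f' m := by
  rw [frac, map_add, add_div]; rfl

lemma frac_mul (f f' : K[X]) (m m' : ℕ) :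
    frac α f m * frac α f' m' = frac α (f * f') (m + m') := by
  rw [frac, frac, frac, div_mul_div_comm, map_mul, pow_add]

lemma frac_pow (f : K[X]) (m j : ℕ) : frac α f m ^ j = frac α (f ^ j) (m * j) := by
  rw [frac, frac, div_pow, map_pow, pow_mul]

lemma frac_locEq_pow_mul (f : K[X]) (m j : ℕ) :
    frac α (locEq α ^ j * f) (j + m) = frac α f m := by
  rw [frac, frac, map_mul, map_pow, pow_add,
    mul_div_mul_left _ _ (pow_ne_zero _ (algebraMap_locEq_ne_zero α))]

lemma frac_locEq_pow (j : ℕ) : frac α (locEq α ^ j) j = 1 := by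
  rw [frac, map_pow, div_self (pow_ne_zero _ (algebraMap_locEq_ne_zero α))]

lemma frac_C (c : K) : frac α (C c) 0 = RatFunc.C c := by
  rw [frac, pow_zero, div_one, RatFunc.algebraMap_C]

lemma frac_one_zero : frac α 1 0 = 1 := by
  rw [frac, pow_zero, div_one, map_one]

lemma frac_zero (m : ℕ) : frac α 0 m = 0 := by
  rw [frac, map_zero, zero_div]

lemma frac_sum {ι : Type*} (s : Finset ι) (f : ι → K[X]) (m : ℕ) :
    frac α (∑ a ∈ s, f a) m = ∑ a ∈ s, frac α (f a) m := by
  rw [frac, map_sum, Finset.sum_div]; rfl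

lemma frac_C_mul (c : K) (f : K[X]) (m : ℕ) : frac α (C c * f) m = c • frac α f m := by
  rw [← zero_add m, ← frac_mul, zero_add, frac_C, Algebra.smul_def]; rfl

variable {α}

lemma frac_inj {f f' : K[X]} {m : ℕ} : frac α f m = frac α f' m ↔ f = f' := by
  rw [frac, frac, div_left_inj' (pow_ne_zero _ (algebraMap_locEq_ne_zero α))]
  exact (IsFractionRing.injective K[X] (RatFunc K)).eq_iff

lemma frac_eq_zero_iff {f : K[X]} {m : ℕ} : frac α f m = 0 ↔ f = 0 := by
  rw [← frac_zero α m, frac_inj]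

end frac

/-- The section ring of `D = ∑ (1 / n) Pᵢ`. -/
noncomputable abbrev fracRing (n : ℕ) (α : Fin k → K) : Subalgebra K (RatFunc K)[X] :=
  sectionRing (fractionalPoints n α)

variable {n : ℕ} {α : Fin k → K}

lemma exists_coeff_eq (hα : Function.Injective α) (F : fracRing n α) (i : ℕ) :
    ∃ f : K[X], f.natDegree ≤ k * (i / n) ∧ (F : (RatFunc K)[X]).coeff i = frac α f (i / n) :=
  (mem_sections_iff n hα i _).1 (F.2 i)

lemma monomial_frac_mem (hn : 0 < n) (hα : Function.Injective α) {i m : ℕ} {f : K[X]}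
    (h1 : n * m ≤ i) (h2 : f.natDegree ≤ k * m) : monomial i (frac α f m) ∈ fracRing n α := by
  intro j
  rw [coeff_monomial]
  split_ifs with hj
  · subst hj
    obtain ⟨d, hd⟩ := Nat.exists_eq_add_of_le' ((Nat.le_div_iff_mul_le hn).2 (mul_comm n m ▸ h1))
    refine (mem_sections_iff n hα i _).2 ⟨locEq α ^ d * f, ?_, ?_⟩
    · refine natDegree_mul_le.trans ?_
      rw [natDegree_locEq_pow, hd, mul_add]
      omega
    · rw [hd]
      exact (frac_locEq_pow_mul α f m d).symm
  · exact zero_mem _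

/-- The homogeneous element `(f / g ^ m) Tⁱ` of the section ring. -/
noncomputable def sec (hn : 0 < n) (hα : Function.Injective α) (i m : ℕ) (f : K[X])
    (h1 : n * m ≤ i) (h2 : f.natDegree ≤ k * m) : fracRing n α :=
  ⟨monomial i (frac α f m), monomial_frac_mem hn hα h1 h2⟩

lemma coe_sec (hn : 0 < n) (hα : Function.Injective α) (i m : ℕ) (f : K[X])
    (h1 : n * m ≤ i) (h2 : f.natDegree ≤ k * m) :
    (sec hn hα i m f h1 h2 : (RatFunc K)[X]) = monomial i (frac α f m) := rfl

/-- The degree one element `Y = T`. -/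
noncomputable def elemY (hn : 0 < n) (hα : Function.Injective α) : fracRing n α :=
  ⟨X, by
    have := monomial_frac_mem hn hα (i := 1) (m := 0) (f := 1) (by simp) (by simp)
    rwa [frac_one_zero, monomial_one_one_eq_X] at this⟩

lemma coe_elemY (hn : 0 < n) (hα : Function.Injective α) :
    (elemY hn hα : (RatFunc K)[X]) = X := rfl

/-- The element `h = Tⁿ / g` of degree `n`. Together with `Y` it is a homogeneous system of
parameters, and the section ring is finite over `K[Y, h]`. -/
noncomputable def elemH (hn : 0 < n) (hα : Function.Injective α) : fracRing n α :=
  sec hn hα n 1 1 (by simp) (by simp)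

lemma coe_elemH (hn : 0 < n) (hα : Function.Injective α) :
    (elemH hn hα : (RatFunc K)[X]) = monomial n (frac α 1 1) := rfl

lemma coe_elemH_pow (hn : 0 < n) (hα : Function.Injective α) (j : ℕ) :
    ((elemH hn hα ^ j : fracRing n α) : (RatFunc K)[X]) = monomial (n * j) (frac α 1 j) := by
  rw [SubmonoidClass.coe_pow, coe_elemH, monomial_pow, frac_pow, one_pow, one_mul]

lemma coe_elemY_pow (hn : 0 < n) (hα : Function.Injective α) (j : ℕ) :
    ((elemY hn hα ^ j : fracRing n α) : (RatFunc K)[X]) = X ^ j := by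
  rw [SubmonoidClass.coe_pow, coe_elemY]

lemma elemY_ne_zero (hn : 0 < n) (hα : Function.Injective α) : elemY hn hα ≠ 0 :=
  fun h => X_ne_zero (congrArg Subtype.val h)

lemma elemY_pow_mul_sec (hn : 0 < n) (hα : Function.Injective α) (j i m : ℕ) (f : K[X])
    (h1 : n * m ≤ i) (h2 : f.natDegree ≤ k * m) (h1' : n * m ≤ i + j) :
    elemY hn hα ^ j * sec hn hα i m f h1 h2 = sec hn hα (i + j) m f h1' h2 :=
  Subtype.ext (by
    rw [MulMemClass.coe_mul, coe_elemY_pow, coe_sec, coe_sec, X_pow_mul_monomial])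

lemma sec_zero_C (hn : 0 < n) (hα : Function.Injective α) (c : K) :
    sec hn hα (n * 0) 0 (C c) le_rfl (by simp) = algebraMap K (fracRing n α) c :=
  Subtype.ext (by
    rw [coe_sec, frac_C, mul_zero, monomial_zero_left]; rfl)

lemma exists_component_eq_sec (hn : 0 < n) (hα : Function.Injective α) (F : fracRing n α)
    (i : ℕ) : ∃ (f : K[X]) (h2 : f.natDegree ≤ k * (i / n)),
      component _ i F = sec hn hα i (i / n) f (Nat.mul_div_le i n) h2 := by
  obtain ⟨f, hf, h⟩ := exists_coeff_eq hα F i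
  exact ⟨f, hf, Subtype.ext (by rw [coe_component, h, coe_sec])⟩

/-- Induction principle: the section ring is spanned by the elements
`Yʲ · (f / g ^ m) T ^ (n m)`. -/
lemma sec_induction (hn : 0 < n) (hα : Function.Injective α) {P : fracRing n α → Prop}
    (hadd : ∀ F G, P F → P G → P (F + G)) (hY : ∀ F, P F → P (elemY hn hα * F))
    (hsec : ∀ (m : ℕ) (f : K[X]) (h2 : f.natDegree ≤ k * m),
      P (sec hn hα (n * m) m f le_rfl h2)) (F : fracRing n α) : P F := by
  have h0 : P 0 := by
    have := hsec 0 (C 0) (by simp)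
    rwa [sec_zero_C, map_zero] at this
  rw [← sum_component _ F]
  refine Finset.sum_induction _ P hadd h0 fun i _ => ?_
  obtain ⟨f, h2, h⟩ := exists_component_eq_sec hn hα F i
  have hpow : ∀ j G, P G → P (elemY hn hα ^ j * G) := by
    intro j G hG
    induction j with
    | zero => simpa using hG
    | succ j ih => rw [pow_succ', mul_assoc]; exact hY _ ih
  have := hpow (i - n * (i / n)) _ (hsec (i / n) f h2)
  have hle := Nat.mul_div_le i n
  rw [elemY_pow_mul_sec hn hα _ _ _ _ _ _ (by omega)] at this
  rw [h]
  convert this using 2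
  omega

/-! ### Degree zero part and generators -/

lemma sectionRingGrading_zero (hα : Function.Injective α) :
    sectionRingGrading (fractionalPoints n α) 0 = 1 := by
  refine le_antisymm (fun F hF => ?_) (Submodule.one_le.2 fun j hj => ?_)
  · obtain ⟨f, hf, h⟩ := exists_coeff_eq hα F 0
    rw [Nat.zero_div, mul_zero, Nat.le_zero] at hf
    rw [Submodule.mem_one]
    refine ⟨f.coeff 0, Subtype.ext (Polynomial.ext fun j => ?_)⟩
    have h1 : (algebraMap K (fracRing n α) (f.coeff 0) : (RatFunc K)[X]) =
      C (RatFunc.C (f.coeff 0)) := rfl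
    rw [h1, coeff_C]
    split_ifs with hj
    · rw [hj, h, Nat.zero_div, eq_C_of_natDegree_eq_zero hf, frac_C, coeff_C_zero]
    · exact (hF j hj).symm
  · rw [OneMemClass.coe_one, coeff_one, if_neg hj]

/-- The cofactor `∏_{i ≠ j} (x - αᵢ)`. -/
noncomputable abbrev cofactor (α : Fin k → K) (j : Fin k) : K[X] :=
  Lagrange.nodal (Finset.univ.erase j) α

lemma locEq_eq_mul_cofactor (α : Fin k → K) (j : Fin k) :
    locEq α = (X - C (α j)) * cofactor α j :=
  Lagrange.nodal_eq_mul_nodal_erase (Finset.mem_univ j)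

lemma natDegree_X_mul_cofactor (α : Fin k → K) (j : Fin k) :
    (X * cofactor α j).natDegree = k := by
  rw [natDegree_X_mul Lagrange.nodal_ne_zero, Lagrange.natDegree_nodal,
    Finset.card_erase_of_mem (Finset.mem_univ j), Finset.card_univ, Fintype.card_fin]
  have := j.pos
  omega

lemma eval_X_mul_cofactor_of_ne (α : Fin k → K) {i j : Fin k} (h : i ≠ j) :
    (X * cofactor α i).eval (α j) = 0 := by
  rw [eval_mul, Lagrange.eval_nodal_at_node (Finset.mem_erase.2 ⟨h.symm, Finset.mem_univ j⟩),
    mul_zero]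

lemma eval_X_mul_cofactor_self_ne_zero (hα : Function.Injective α) (hα0 : ∀ i, α i ≠ 0)
    (j : Fin k) : (X * cofactor α j).eval (α j) ≠ 0 := by
  rw [eval_mul, eval_X]
  refine mul_ne_zero (hα0 j) (Lagrange.eval_nodal_not_at_node fun i hi h => ?_)
  exact Finset.ne_of_mem_erase hi (hα h).symm

/-- The element `A j = x / (x - α j) * T ^ n`. -/
noncomputable def elemA (hn : 0 < n) (hα : Function.Injective α) (j : Fin k) : fracRing n α :=
  sec hn hα n 1 (X * cofactor α j) (by simp) (by rw [natDegree_X_mul_cofactor, mul_one])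

lemma frac_X_mul_cofactor (j : Fin k) :
    frac α (X * cofactor α j) 1 = RatFunc.X / (RatFunc.X - RatFunc.C (α j)) := by
  have h : algebraMap K[X] (RatFunc K) (cofactor α j) ≠ 0 :=
    (map_ne_zero_iff _ (IsFractionRing.injective _ _)).2 Lagrange.nodal_ne_zero
  rw [frac, pow_one, locEq_eq_mul_cofactor α j, map_mul, map_mul, mul_div_mul_right _ _ h, map_sub,
    RatFunc.algebraMap_X, RatFunc.algebraMap_C]

lemma coe_elemA (hn : 0 < n) (hα : Function.Injective α) (j : Fin k) :
    (elemA hn hα j : (RatFunc K)[X]) =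
      C (RatFunc.X / (RatFunc.X - RatFunc.C (α j))) * X ^ n := by
  rw [elemA, coe_sec, frac_X_mul_cofactor, C_mul_X_pow_eq_monomial]

lemma elemA_pow (hn : 0 < n) (hα : Function.Injective α) (j : Fin k) (m : ℕ) :
    elemA hn hα j ^ m = sec hn hα (n * m) m ((X * cofactor α j) ^ m) le_rfl
      (by rw [natDegree_pow, natDegree_X_mul_cofactor, mul_comm]) :=
  Subtype.ext (by
    rw [SubmonoidClass.coe_pow, elemA, coe_sec, coe_sec, monomial_pow, frac_pow, one_mul])

/-- Every `f` of degree at most `k (m + 1)` is, modulo `g`, a combination of the numerators of the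
`A j ^ (m + 1)`, and the remaining multiple of `g` has cofactor of degree at most `k m`. -/
lemma exists_eq_sum_add_locEq_mul (hα : Function.Injective α) (hα0 : ∀ i, α i ≠ 0) {m : ℕ}
    {f : K[X]} (hf : f.natDegree ≤ k * (m + 1)) :
    ∃ (c : Fin k → K) (f' : K[X]), f'.natDegree ≤ k * m ∧
      f = ∑ j, C (c j) * (X * cofactor α j) ^ (m + 1) + locEq α * f' := by
  let c : Fin k → K := fun j => f.eval (α j) / ((X * cofactor α j).eval (α j)) ^ (m + 1)
  obtain ⟨f', hf'⟩ := locEq_dvd_of_eval_eq_zero hα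
    (f := f - ∑ j, C (c j) * (X * cofactor α j) ^ (m + 1)) (by
      intro j
      rw [eval_sub, eval_finsetSum, Finset.sum_eq_single j]
      · rw [eval_mul, eval_C, eval_pow,
          div_mul_cancel₀ _ (pow_ne_zero _ (eval_X_mul_cofactor_self_ne_zero hα hα0 j)), sub_self]
      · intro i _ hij
        rw [eval_mul, eval_pow, eval_X_mul_cofactor_of_ne α hij, zero_pow (by omega), mul_zero]
      · simp)
  refine ⟨c, f', ?_, by rw [← hf', add_sub_cancel]⟩
  have hdeg : (locEq α * f').natDegree ≤ k * (m + 1) := by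
    rw [← hf']
    refine (natDegree_sub_le _ _).trans (max_le hf
      (natDegree_sum_le_of_forall_le _ _ fun j _ => ?_))
    refine (natDegree_C_mul_le _ _).trans ?_
    rw [natDegree_pow, natDegree_X_mul_cofactor, mul_comm]
  by_cases h0 : f' = 0
  · simp [h0]
  rw [(locEq_monic α).natDegree_mul' h0, natDegree_locEq, mul_add] at hdeg
  omega

lemma sec_succ_eq_sum_add (hn : 0 < n) (hα : Function.Injective α) (hα0 : ∀ i, α i ≠ 0) (m : ℕ)
    (f : K[X]) (hf : f.natDegree ≤ k * (m + 1)) :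
    ∃ (c : Fin k → K) (f' : K[X]) (hf' : f'.natDegree ≤ k * m),
      sec hn hα (n * (m + 1)) (m + 1) f le_rfl hf =
        ∑ j, c j • elemA hn hα j ^ (m + 1) +
          elemY hn hα ^ n * sec hn hα (n * m) m f' le_rfl hf' := by
  obtain ⟨c, f', hf', h⟩ := exists_eq_sum_add_locEq_mul hα hα0 hf
  refine ⟨c, f', hf', ?_⟩
  have e : ((∑ j, c j • elemA hn hα j ^ (m + 1) : fracRing n α) : (RatFunc K)[X]) =
      monomial (n * (m + 1)) (frac α (∑ j, C (c j) * (X * cofactor α j) ^ (m + 1)) (m + 1)) := by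
    rw [frac_sum, map_sum, AddSubmonoidClass.coe_finsetSum]
    refine Finset.sum_congr rfl fun j _ => ?_
    rw [SetLike.val_smul, elemA_pow, coe_sec, smul_monomial, frac_C_mul]
  refine Subtype.ext ?_
  rw [AddMemClass.coe_add, e, elemY_pow_mul_sec hn hα _ _ _ _ _ _ (by omega), coe_sec, coe_sec, h,
    frac_add, map_add]
  congr 2
  rw [add_comm m 1, ← pow_one (locEq α), frac_locEq_pow_mul]

theorem adjoin_elemY_elemA (hn : 0 < n) (hα : Function.Injective α) (hα0 : ∀ i, α i ≠ 0) :
    Algebra.adjoin K (insert (elemY hn hα) (Set.range (elemA hn hα))) = ⊤ := by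
  set B := Algebra.adjoin K (insert (elemY hn hα) (Set.range (elemA hn hα)))
  have hYB : elemY hn hα ∈ B := Algebra.subset_adjoin (Set.mem_insert _ _)
  have hAB : ∀ j, elemA hn hα j ∈ B := fun j =>
    Algebra.subset_adjoin (Set.mem_insert_of_mem _ (Set.mem_range_self j))
  refine top_unique fun F _ => ?_
  refine sec_induction hn hα (P := (· ∈ B)) (fun _ _ => add_mem) (fun _ => mul_mem hYB) ?_ F
  intro m
  induction m with
  | zero =>
    intro f h2
    have h2' := h2
    rw [mul_zero, Nat.le_zero] at h2'
    have := eq_C_of_natDegree_eq_zero h2'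
    generalize f.coeff 0 = c at this
    subst this
    rw [sec_zero_C]
    exact B.algebraMap_mem _
  | succ m ih =>
    intro f h2
    obtain ⟨c, f', hf', h⟩ := sec_succ_eq_sum_add hn hα hα0 m f h2
    rw [h]
    exact add_mem (sum_mem fun j _ => B.smul_mem (pow_mem (hAB j) _) _)
      (mul_mem (pow_mem hYB _) (ih _ _))

theorem finiteType_fracRing (hn : 0 < n) (hα : Function.Injective α) (hα0 : ∀ i, α i ≠ 0) :
    Algebra.FiniteType K (fracRing n α) :=
  ⟨Subalgebra.fg_def.2 ⟨_, (Set.finite_range _).insert _, adjoin_elemY_elemA hn hα hα0⟩⟩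

theorem isNoetherianRing_fracRing (hn : 0 < n) (hα : Function.Injective α)
    (hα0 : ∀ i, α i ≠ 0) : IsNoetherianRing (fracRing n α) :=
  have := finiteType_fracRing hn hα hα0
  Algebra.FiniteType.isNoetherianRing K _

end ProjLine

/-! ### F-purity from a splitting of Frobenius -/

/-- An additive `φ : S → S` with `φ (s ^ p r) = s φ(r)` and `φ 1 = 1` is a splitting of Frobenius,
so it makes `S` F-pure. -/
lemma IsFPure.of_splitting {p : ℕ} {S : Type u} [CommRing S] [ExpChar S p] (φ : S →+ S)
    (hφ : ∀ s r, φ (s ^ p * r) = s * φ r) (h1 : φ 1 = 1) : IsFPure p S := by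
  intro M _ _
  let φ' : FrobeniusAlg p S →ₗ[S] S :=
    { toFun := φ
      map_add' := φ.map_add
      map_smul' := fun s r => hφ s r }
  let ψ : FrobeniusAlg p S ⊗[S] M →ₗ[S] M :=
    (TensorProduct.lid S M).toLinearMap ∘ₗ TensorProduct.map φ' LinearMap.id
  refine Function.LeftInverse.injective (g := ψ) fun m => ?_
  have h1' : φ' 1 = 1 := h1
  change TensorProduct.lid S M (TensorProduct.map φ' LinearMap.id (1 ⊗ₜ m)) = m
  rw [TensorProduct.map_tmul, h1', TensorProduct.lid_tmul, LinearMap.id_apply, one_smul]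

/-- Splittings of Frobenius are transported along ring isomorphisms. -/
lemma IsFPure.of_ringEquiv_splitting {p : ℕ} {S : Type u} {S' : Type*} [CommRing S] [ExpChar S p]
    [CommRing S'] (e : S ≃+* S') (φ : S' →+ S') (hφ : ∀ s r, φ (s ^ p * r) = s * φ r)
    (h1 : φ 1 = 1) : IsFPure p S := by
  refine .of_splitting ((e.symm.toAddEquiv.toAddMonoidHom.comp φ).comp
    e.toAddEquiv.toAddMonoidHom) (fun s r => ?_) ?_
  · change e.symm (φ (e (s ^ p * r))) = s * e.symm (φ (e r))
    rw [map_mul, map_pow, hφ, map_mul, e.symm_apply_apply]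
  · change e.symm (φ (e 1)) = 1
    rw [map_one, h1, map_one]

/-- A field of characteristic `p` has an additive map `μ` with `μ (c ^ p x) = c μ(x)`, `μ 1 = 1`. -/
lemma exists_field_frobenius_splitting (p : ℕ) (K : Type*) [Field K] [ExpChar K p] :
    ∃ μ : K →+ K, (∀ c x, μ (c ^ p * x) = c * μ x) ∧ μ 1 = 1 := by
  let _ : Module K (FrobeniusAlg p K) := Algebra.toModule
  have hinj : (Algebra.linearMap K (FrobeniusAlg p K)).ker = ⊥ :=
    LinearMap.ker_eq_bot.2 (frobenius_inj K p)
  obtain ⟨g, hg⟩ := LinearMap.exists_leftInverse_of_injective _ hinj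
  refine ⟨g.toAddMonoidHom, fun c x => g.map_smul c (x : FrobeniusAlg p K), ?_⟩
  have := LinearMap.congr_fun hg 1
  rw [LinearMap.comp_apply, LinearMap.id_apply, Algebra.linearMap_apply, map_one] at this
  exact this

namespace MvPolynomial

variable {σ K : Type*} [Field K]

/-- The map `∑ cₘ xᵐ ↦ ∑ μ(c_{pm}) xᵐ`, for an additive `μ : K → K` and `p ≠ 0`. -/
noncomputable def frobeniusTrace {p : ℕ} (hp : p ≠ 0) (μ : K →+ K) :
    MvPolynomial σ K →+ MvPolynomial σ K :=
  AddMonoidAlgebra.coeffAddEquiv.symm.toAddMonoidHom.comp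
    ((Finsupp.mapRange.addMonoidHom μ).comp
      ((Finsupp.comapDomain.addMonoidHom (f := fun m : σ →₀ ℕ => p • m)
        (smul_right_injective _ hp)).comp AddMonoidAlgebra.coeffAddEquiv.toAddMonoidHom))

lemma coeff_frobeniusTrace {p : ℕ} (hp : p ≠ 0) (μ : K →+ K) (f : MvPolynomial σ K)
    (m : σ →₀ ℕ) : coeff m (frobeniusTrace hp μ f) = μ (coeff (p • m) f) := rfl

lemma frobeniusTrace_pow_mul {p : ℕ} (hp : p ≠ 0) [ExpChar K p] {μ : K →+ K}
    (hμ : ∀ c x, μ (c ^ p * x) = c * μ x) (f r : MvPolynomial σ K) :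
    frobeniusTrace hp μ (f ^ p * r) = f * frobeniusTrace hp μ r := by
  induction f using MvPolynomial.induction_on' with
  | monomial a c =>
    ext m
    have hle : p • a ≤ p • m ↔ a ≤ m := by
      simp only [Finsupp.le_def, Finsupp.smul_apply, smul_eq_mul]
      exact forall_congr' fun i => Nat.mul_le_mul_left_iff (Nat.pos_of_ne_zero hp)
    rw [coeff_frobeniusTrace, monomial_pow, coeff_monomial_mul', coeff_monomial_mul']
    by_cases h : a ≤ m
    · rw [if_pos (hle.2 h), if_pos h, hμ, coeff_frobeniusTrace]
      congr 3
      ext i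
      simp [Nat.mul_sub]
    · rw [if_neg (hle.not.2 h), if_neg h, map_zero]
  | add f f' hf hf' =>
    rw [add_pow_expChar, add_mul, map_add, hf, hf', add_mul]

lemma frobeniusTrace_one {p : ℕ} (hp : p ≠ 0) {μ : K →+ K} (h1 : μ 1 = 1) :
    frobeniusTrace hp μ (1 : MvPolynomial σ K) = 1 := by
  classical
  ext m
  rw [coeff_frobeniusTrace, coeff_one, coeff_one]
  by_cases h : m = 0
  · simp [h, h1]
  · rw [if_neg (Ne.symm h), if_neg, map_zero]
    intro h'
    exact (smul_ne_zero hp h) h'.symm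

/-- The ideal generated by the products of two distinct variables. -/
noncomputable abbrev crossIdeal (σ K : Type*) [Field K] : Ideal (MvPolynomial σ K) :=
  Ideal.span {f | ∃ i j : σ, i ≠ j ∧ f = X i * X j}

lemma mem_crossIdeal_iff {f : MvPolynomial σ K} :
    f ∈ crossIdeal σ K ↔ ∀ m, coeff m f ≠ 0 → ∃ i j, i ≠ j ∧ m i ≠ 0 ∧ m j ≠ 0 := by
  classical
  have hset : {f : MvPolynomial σ K | ∃ i j : σ, i ≠ j ∧ f = X i * X j} =
      (fun s => monomial s (1 : K)) ''
        {s | ∃ i j, i ≠ j ∧ s = Finsupp.single i 1 + Finsupp.single j 1} := by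
    ext f
    constructor
    · rintro ⟨i, j, hij, rfl⟩
      refine ⟨_, ⟨i, j, hij, rfl⟩, ?_⟩
      simp [X, monomial_mul]
    · rintro ⟨_, ⟨i, j, hij, rfl⟩, rfl⟩
      refine ⟨i, j, hij, ?_⟩
      simp [X, monomial_mul]
  rw [crossIdeal, hset, mem_ideal_span_monomial_image]
  refine forall_congr' fun m => ?_
  rw [mem_support_iff]
  refine imp_congr_right fun _ => ?_
  constructor
  · rintro ⟨_, ⟨i, j, hij, rfl⟩, h⟩
    refine ⟨i, j, hij, ?_, ?_⟩
    · have := h i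
      rw [Finsupp.add_apply, Finsupp.single_eq_same] at this
      omega
    · have := h j
      rw [Finsupp.add_apply, Finsupp.single_eq_same] at this
      omega
  · rintro ⟨i, j, hij, hi, hj⟩
    refine ⟨_, ⟨i, j, hij, rfl⟩, fun l => ?_⟩
    rw [Finsupp.add_apply, Finsupp.single_apply, Finsupp.single_apply]
    by_cases h1 : i = l
    · subst h1
      rw [if_pos rfl, if_neg hij.symm]
      omega
    · rw [if_neg h1]
      split_ifs with h2
      · subst h2; omega
      · omega

/-- A ring isomorphic to `K[x_i] / (x_i x_j : i ≠ j)` is F-pure. -/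
theorem isFPure_of_ringEquiv_quotient_crossIdeal {p : ℕ} [Fact p.Prime] [CharP K p] {S : Type u}
    [CommRing S] [ExpChar S p] (e : S ≃+* MvPolynomial σ K ⧸ crossIdeal σ K) : IsFPure p S := by
  obtain ⟨μ, hμ, hμ1⟩ := exists_field_frobenius_splitting p K
  have hp : p ≠ 0 := (Fact.out : p.Prime).ne_zero
  let τ : MvPolynomial σ K →+ MvPolynomial σ K := frobeniusTrace hp μ
  have hτ : (crossIdeal σ K).toAddSubgroup ≤ (crossIdeal σ K).toAddSubgroup.comap τ := by
    intro f hf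
    refine mem_crossIdeal_iff.2 fun m hm => ?_
    rw [coeff_frobeniusTrace] at hm
    obtain ⟨i, j, hij, hi, hj⟩ := mem_crossIdeal_iff.1 hf (p • m) fun h => hm (by rw [h, map_zero])
    rw [Finsupp.smul_apply, smul_eq_mul] at hi hj
    exact ⟨i, j, hij, right_ne_zero_of_mul hi, right_ne_zero_of_mul hj⟩
  let φ : (MvPolynomial σ K ⧸ crossIdeal σ K) →+ (MvPolynomial σ K ⧸ crossIdeal σ K) :=
    QuotientAddGroup.map _ _ τ hτ
  have hφ : ∀ f, φ (Ideal.Quotient.mk _ f) = Ideal.Quotient.mk _ (τ f) := fun f => rfl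
  refine .of_ringEquiv_splitting e φ (fun s r => ?_) ?_
  · obtain ⟨s, rfl⟩ := Ideal.Quotient.mk_surjective s
    obtain ⟨r, rfl⟩ := Ideal.Quotient.mk_surjective r
    rw [← map_pow, ← map_mul, hφ, hφ, ← map_mul, frobeniusTrace_pow_mul hp hμ]
  · rw [← map_one (Ideal.Quotient.mk _), hφ, frobeniusTrace_one hp hμ1]

end MvPolynomial

namespace ProjLine

open Polynomial

variable {K : Type u} [Field K] {n k : ℕ} {α : Fin k → K}

/-! ### The quotient by `Y` -/

lemma coe_aeval_elemA_monomial (hn : 0 < n) (hα : Function.Injective α) (m : Fin k →₀ ℕ) (c : K) :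
    (MvPolynomial.aeval (elemA hn hα) (MvPolynomial.monomial m c) : (RatFunc K)[X]) =
      monomial (n * m.degree) (frac α (C c * ∏ j, (X * cofactor α j) ^ m j) m.degree) := by
  have e : ∀ s : Finset (Fin k), ((∏ j ∈ s, elemA hn hα j ^ m j : fracRing n α) : (RatFunc K)[X]) =
      monomial (n * ∑ j ∈ s, m j)
        (frac α (∏ j ∈ s, (X * cofactor α j) ^ m j) (∑ j ∈ s, m j)) := by
    intro s
    classical
    induction s using Finset.induction_on with
    | empty => simp [frac_one_zero]
    | insert j s hj ih =>
      rw [Finset.prod_insert hj, Finset.sum_insert hj, Finset.prod_insert hj, MulMemClass.coe_mul,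
        ih, elemA_pow, coe_sec, monomial_mul_monomial, frac_mul, mul_add]
  rw [MvPolynomial.aeval_monomial, ← Algebra.smul_def, SetLike.val_smul,
    Finsupp.prod_fintype _ _ (fun _ => pow_zero _), e, smul_monomial, Finsupp.degree_eq_sum]
  rw [frac_C_mul]

lemma coeff_aeval_elemA (hn : 0 < n) (hα : Function.Injective α) (f : MvPolynomial (Fin k) K)
    (e : ℕ) : (MvPolynomial.aeval (elemA hn hα) f : (RatFunc K)[X]).coeff (n * e) =
      frac α (∑ m ∈ f.support with m.degree = e,
        C (f.coeff m) * ∏ j, (X * cofactor α j) ^ m j) e := by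
  conv_lhs => rw [f.as_sum, map_sum, AddSubmonoidClass.coe_finsetSum, finsetSum_coeff]
  rw [frac_sum, Finset.sum_filter]
  refine Finset.sum_congr rfl fun m _ => ?_
  rw [coe_aeval_elemA_monomial, coeff_monomial]
  by_cases h : m.degree = e
  · rw [if_pos h, if_pos (by rw [h]), h]
  · rw [if_neg h, if_neg]
    rwa [Nat.mul_right_inj hn.ne']

/-- An element of `YR` has, in degree `n e`, a numerator that is divisible by `g`. -/
lemma locEq_dvd_of_elemY_dvd (hn : 0 < n) (hα : Function.Injective α) {F : fracRing n α}
    (hF : elemY hn hα ∣ F) {e : ℕ} {f : K[X]}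
    (hf : (F : (RatFunc K)[X]).coeff (n * e) = frac α f e) :
    f = 0 ∨ e ≠ 0 ∧ locEq α ∣ f := by
  obtain ⟨G, rfl⟩ := hF
  rw [MulMemClass.coe_mul, coe_elemY] at hf
  rcases e with _ | e
  · left
    rw [mul_zero, mul_coeff_zero, coeff_X_zero, zero_mul] at hf
    exact frac_eq_zero_iff.1 hf.symm
  · right
    refine ⟨by omega, ?_⟩
    have h1 : n * (e + 1) = (n * e + (n - 1)) + 1 := by rw [mul_add]; omega
    obtain ⟨f', -, hf'⟩ := exists_coeff_eq hα G (n * e + (n - 1))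
    have h2 : (n * e + (n - 1)) / n = e := by
      rw [Nat.mul_add_div hn, Nat.div_eq_of_lt (by omega), add_zero]
    rw [h1, coeff_X_mul, hf', h2, ← frac_locEq_pow_mul α f' e 1, add_comm 1 e, frac_inj] at hf
    exact ⟨f', by rw [← hf, pow_one]⟩

lemma elemA_mul_elemA_mem (hn : 0 < n) (hα : Function.Injective α) {i j : Fin k} (hij : i ≠ j) :
    elemA hn hα i * elemA hn hα j ∈ Ideal.span {elemY hn hα} := by
  have hdeg : (X * cofactor α i * (X * cofactor α j)).natDegree ≤ k * (1 + 1) :=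
    natDegree_mul_le.trans (by rw [natDegree_X_mul_cofactor, natDegree_X_mul_cofactor]; omega)
  have hdvd : locEq α ∣ X * cofactor α i * (X * cofactor α j) := by
    refine locEq_dvd_of_eval_eq_zero hα fun l => ?_
    rw [eval_mul]
    by_cases hl : i = l
    · subst hl
      rw [eval_X_mul_cofactor_of_ne α hij.symm, mul_zero]
    · rw [eval_X_mul_cofactor_of_ne α hl, zero_mul]
  obtain ⟨f, hf⟩ := hdvd
  have h0 : X * cofactor α i * (X * cofactor α j) ≠ 0 :=
    mul_ne_zero (mul_ne_zero X_ne_zero Lagrange.nodal_ne_zero)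
      (mul_ne_zero X_ne_zero Lagrange.nodal_ne_zero)
  have hf0 : f ≠ 0 := by rintro rfl; exact h0 (by rw [hf, mul_zero])
  have hfd : f.natDegree ≤ k * 1 := by
    rw [hf, (locEq_monic α).natDegree_mul' hf0, natDegree_locEq] at hdeg
    omega
  have key : elemA hn hα i * elemA hn hα j =
      elemY hn hα ^ n * sec hn hα n 1 f (by simp) hfd := by
    refine Subtype.ext ?_
    rw [MulMemClass.coe_mul, MulMemClass.coe_mul, elemA, elemA, coe_sec, coe_sec, coe_sec,
      coe_elemY_pow, monomial_mul_monomial, frac_mul, hf, X_pow_mul_monomial]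
    have := frac_locEq_pow_mul α f 1 1
    rw [pow_one] at this
    rw [this]
  rw [key]
  exact Ideal.mul_mem_right _ _ (Ideal.pow_mem_of_mem _ (Ideal.mem_span_singleton_self _) _ hn)

lemma aeval_elemA_mem_span_elemY_iff (hn : 0 < n) (hα : Function.Injective α)
    (hα0 : ∀ i, α i ≠ 0) (f : MvPolynomial (Fin k) K) :
    MvPolynomial.aeval (elemA hn hα) f ∈ Ideal.span {elemY hn hα} ↔
      f ∈ MvPolynomial.crossIdeal (Fin k) K := by
  constructor
  · intro h
    refine MvPolynomial.mem_crossIdeal_iff.2 fun m hm => ?_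
    by_contra! hcross
    have hmem : m ∈ f.support.filter fun m' => m'.degree = m.degree :=
      Finset.mem_filter.2 ⟨MvPolynomial.mem_support_iff.2 hm, rfl⟩
    have hdvd := locEq_dvd_of_elemY_dvd hn hα (Ideal.mem_span_singleton.1 h)
      (coeff_aeval_elemA hn hα f m.degree)
    by_cases hm0 : m = 0
    · subst hm0
      have h0 := hdvd.resolve_right fun h => h.1 (map_zero _)
      rw [Finset.sum_eq_single_of_mem _ hmem] at h0
      · simp at h0
        exact hm h0
      · intro m' hm' hne
        exact absurd ((Finsupp.degree_eq_zero_iff m').1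
          ((Finset.mem_filter.1 hm').2.trans (map_zero _))) hne
    · obtain ⟨j, hj⟩ := Finsupp.ne_iff.1 hm0
      have hsingle : ∀ i, i ≠ j → m i = 0 := fun i hij => by
        by_contra hi
        exact hj (hcross i j hij hi)
      have hdj : m.degree = m j := by
        rw [Finsupp.degree_eq_sum, Finset.sum_eq_single j (fun i _ hij => hsingle i hij) (by simp)]
      -- evaluate the numerator at `αⱼ`: only the pure power of the `j`-th variable survives
      have heval : (∑ m' ∈ f.support with m'.degree = m.degree,
          C (f.coeff m') * ∏ i, (X * cofactor α i) ^ m' i).eval (α j) = 0 := by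
        rcases hdvd with h0 | ⟨-, h0⟩
        · rw [h0, eval_zero]
        · exact eval_eq_zero_of_dvd_of_eval_eq_zero h0 (eval_locEq α j)
      rw [eval_finsetSum, Finset.sum_eq_single_of_mem _ hmem, eval_mul, eval_C, eval_prod] at heval
      · refine (mul_ne_zero hm (Finset.prod_ne_zero_iff.2 fun i _ => ?_)) heval
        by_cases hij : i = j
        · subst hij
          rw [eval_pow]
          exact pow_ne_zero _ (eval_X_mul_cofactor_self_ne_zero hα hα0 i)
        · rw [hsingle i hij, pow_zero, eval_one]
          exact one_ne_zero
      · intro m' hm' hne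
        have hex : ∃ i, i ≠ j ∧ m' i ≠ 0 := by
          by_contra! hall
          refine hne (Finsupp.ext fun i => ?_)
          by_cases hij : i = j
          · have h1 := (Finset.mem_filter.1 hm').2
            rw [hdj, Finsupp.degree_eq_sum,
              Finset.sum_eq_single j (fun i _ hij => hall i hij) (by simp)] at h1
            rw [hij, h1]
          · rw [hall i hij, hsingle i hij]
        obtain ⟨i, hij, hi⟩ := hex
        rw [eval_mul, eval_prod, Finset.prod_eq_zero (Finset.mem_univ i), mul_zero]
        rw [eval_pow, eval_X_mul_cofactor_of_ne α hij, zero_pow hi]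
  · intro h
    have hle : MvPolynomial.crossIdeal (Fin k) K ≤
        (Ideal.span {elemY hn hα}).comap (MvPolynomial.aeval (elemA hn hα)) := by
      rw [Ideal.span_le]
      rintro _ ⟨i, j, hij, rfl⟩
      rw [SetLike.mem_coe, Ideal.mem_comap]
      rw [map_mul, MvPolynomial.aeval_X, MvPolynomial.aeval_X]
      exact elemA_mul_elemA_mem hn hα hij
    exact hle h

/-- The map `K[A₁, …, A_k] → R / YR`. -/
noncomputable def quotientMap (hn : 0 < n) (hα : Function.Injective α) :
    MvPolynomial (Fin k) K →ₐ[K] fracRing n α ⧸ Ideal.span {elemY hn hα} :=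
  (Ideal.Quotient.mkₐ K (Ideal.span {elemY hn hα})).comp (MvPolynomial.aeval (elemA hn hα))

lemma quotientMap_surjective (hn : 0 < n) (hα : Function.Injective α) (hα0 : ∀ i, α i ≠ 0) :
    Function.Surjective (quotientMap hn hα) := by
  rw [← AlgHom.range_eq_top, ← top_le_iff,
    ← (AlgHom.range_eq_top (Ideal.Quotient.mkₐ K (Ideal.span {elemY hn hα}))).2
      Ideal.Quotient.mk_surjective,
    ← Algebra.map_top, ← adjoin_elemY_elemA hn hα hα0, AlgHom.map_adjoin, Algebra.adjoin_le_iff]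
  rintro _ ⟨F, hF, rfl⟩
  rcases hF with rfl | ⟨j, rfl⟩
  · have : Ideal.Quotient.mkₐ K (Ideal.span {elemY hn hα}) (elemY hn hα) = 0 :=
      Ideal.Quotient.eq_zero_iff_mem.2 (Ideal.mem_span_singleton_self _)
    rw [this]
    exact zero_mem _
  · refine ⟨MvPolynomial.X j, ?_⟩
    change Ideal.Quotient.mkₐ K _ (MvPolynomial.aeval (elemA hn hα) (MvPolynomial.X j)) = _
    rw [MvPolynomial.aeval_X]

lemma ker_quotientMap (hn : 0 < n) (hα : Function.Injective α) (hα0 : ∀ i, α i ≠ 0) :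
    RingHom.ker (quotientMap hn hα) = MvPolynomial.crossIdeal (Fin k) K := by
  ext f
  rw [← aeval_elemA_mem_span_elemY_iff hn hα hα0, RingHom.mem_ker]
  exact Ideal.Quotient.eq_zero_iff_mem

/-- The isomorphism `R / YR ≃ K[A₁, …, A_k] / (A_i A_j : i ≠ j)`. -/
noncomputable def quotientEquiv (hn : 0 < n) (hα : Function.Injective α) (hα0 : ∀ i, α i ≠ 0) :
    (fracRing n α ⧸ Ideal.span {elemY hn hα}) ≃ₐ[K]
      (MvPolynomial (Fin k) K ⧸ MvPolynomial.crossIdeal (Fin k) K) :=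
  ((Ideal.quotientEquivAlgOfEq K (ker_quotientMap hn hα hα0)).symm.trans
    (Ideal.quotientKerAlgEquivOfSurjective (quotientMap_surjective hn hα hα0))).symm

lemma quotientEquiv_mk_elemA (hn : 0 < n) (hα : Function.Injective α) (hα0 : ∀ i, α i ≠ 0)
    (j : Fin k) : quotientEquiv hn hα hα0 (Ideal.Quotient.mk _ (elemA hn hα j)) =
      Ideal.Quotient.mk _ (MvPolynomial.X j) := by
  rw [quotientEquiv, AlgEquiv.symm_apply_eq]
  change _ = Ideal.Quotient.mkₐ K _ (MvPolynomial.aeval (elemA hn hα) (MvPolynomial.X j))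
  rw [MvPolynomial.aeval_X]
  rfl

end ProjLine

/-! ### Dimension -/

lemma ringKrullDim_le_of_isIntegral (R S : Type*) [CommRing R] [CommRing S] [Algebra R S]
    [Algebra.IsIntegral R S] : ringKrullDim S ≤ ringKrullDim R :=
  Order.krullDim_le_of_strictMono (PrimeSpectrum.comap (algebraMap R S)) fun P Q hPQ =>
    Ideal.IsIntegral.comap_lt_comap (R := R) (I := P.asIdeal) (J := Q.asIdeal) hPQ

namespace ProjLine

open Polynomial

variable {K : Type u} [Field K] {n k : ℕ} {α : Fin k → K}

/-- The section ring is generated by `1` and the `(xᵃ / g) Tⁿ`, `a < k`, as a module over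
`K[Y, h]`: this is expansion of numerators in base `g`. -/
lemma finite_aeval_elemY_elemH (hn : 0 < n) (hk : 0 < k) (hα : Function.Injective α) :
    (MvPolynomial.aeval (R := K) ![elemY hn hα, elemH hn hα]).toRingHom.Finite := by
  let A := MvPolynomial (Fin 2) K
  let ψ : A →ₐ[K] fracRing n α := MvPolynomial.aeval ![elemY hn hα, elemH hn hα]
  let _ : Algebra A (fracRing n α) := ψ.toRingHom.toAlgebra
  let e : Fin k → fracRing n α := fun a => sec hn hα n 1 (X ^ (a : ℕ)) (by simp)
    (by rw [natDegree_X_pow]; omega)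
  let M : Submodule A (fracRing n α) := Submodule.span A (insert 1 (Set.range e))
  have hY : ∀ F ∈ M, elemY hn hα * F ∈ M := fun F hF => by
    have : elemY hn hα * F = (MvPolynomial.X 0 : A) • F := by
      rw [Algebra.smul_def]
      exact congrArg (· * F) (MvPolynomial.aeval_X ![elemY hn hα, elemH hn hα] 0).symm
    rw [this]
    exact M.smul_mem _ hF
  have hH : ∀ F ∈ M, elemH hn hα * F ∈ M := fun F hF => by
    have : elemH hn hα * F = (MvPolynomial.X 1 : A) • F := by
      rw [Algebra.smul_def]
      exact congrArg (· * F) (MvPolynomial.aeval_X ![elemY hn hα, elemH hn hα] 1).symm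
    rw [this]
    exact M.smul_mem _ hF
  have hK : ∀ (c : K), ∀ F ∈ M, c • F ∈ M := fun c F hF => by
    have : c • F = (MvPolynomial.C c : A) • F := by
      rw [Algebra.smul_def, Algebra.smul_def]
      exact congrArg (· * F) (MvPolynomial.aeval_C ![elemY hn hα, elemH hn hα] c).symm
    rw [this]
    exact M.smul_mem _ hF
  have hYp : ∀ j, ∀ F ∈ M, elemY hn hα ^ j * F ∈ M := fun j F hF => by
    induction j with
    | zero => simpa using hF
    | succ j ih => rw [pow_succ', mul_assoc]; exact hY _ ih
  have hHp : ∀ j, ∀ F ∈ M, elemH hn hα ^ j * F ∈ M := fun j F hF => by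
    induction j with
    | zero => simpa using hF
    | succ j ih => rw [pow_succ', mul_assoc]; exact hH _ ih
  have h1 : ∀ (f : K[X]) (h : f.natDegree ≤ k * 1), f.natDegree < k →
      sec hn hα n 1 f (by simp) h ∈ M := by
    intro f h hf
    have hsum : sec hn hα n 1 f (by simp) h = ∑ a : Fin k, f.coeff a • e a := by
      refine Subtype.ext ?_
      rw [AddSubmonoidClass.coe_finsetSum, coe_sec]
      conv_lhs => rw [as_sum_range_C_mul_X_pow' f hf, frac_sum, map_sum,
        ← Fin.sum_univ_eq_sum_range (fun a => monomial n (frac α (C (f.coeff a) * X ^ a) 1))]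
      refine Finset.sum_congr rfl fun a _ => ?_
      rw [frac_C_mul, ← smul_monomial]
      rfl
    rw [hsum]
    exact sum_mem fun a _ => hK _ _ (Submodule.subset_span (Set.mem_insert_of_mem _ ⟨a, rfl⟩))
  have hsec : ∀ (m : ℕ) (f : K[X]) (h2 : f.natDegree ≤ k * m),
      sec hn hα (n * m) m f le_rfl h2 ∈ M := by
    intro m
    induction m with
    | zero =>
      intro f h2
      have h2' := h2
      rw [mul_zero, Nat.le_zero] at h2'
      have := eq_C_of_natDegree_eq_zero h2'
      generalize f.coeff 0 = c at this
      subst this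
      rw [sec_zero_C, Algebra.algebraMap_eq_smul_one]
      exact hK _ _ (Submodule.subset_span (Set.mem_insert _ _))
    | succ m ih =>
      intro f h2
      have hq : (f /ₘ locEq α).natDegree ≤ k * m := by
        rw [natDegree_divByMonic _ (locEq_monic α), natDegree_locEq]
        rw [mul_add] at h2
        omega
      have hr : (f %ₘ locEq α).natDegree < k := by
        have := natDegree_modByMonic_lt f (locEq_monic α) fun h1 => by
          have := natDegree_locEq α
          rw [h1, natDegree_one] at this
          omega
        rwa [natDegree_locEq] at this
      have hr' : (f %ₘ locEq α).natDegree ≤ k * 1 := by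
        rw [mul_one]
        exact hr.le
      have key : sec hn hα (n * (m + 1)) (m + 1) f le_rfl h2 =
          elemY hn hα ^ n * sec hn hα (n * m) m (f /ₘ locEq α) le_rfl hq +
            elemH hn hα ^ m * sec hn hα n 1 (f %ₘ locEq α) (by simp) hr' := by
        refine Subtype.ext ?_
        rw [AddMemClass.coe_add, MulMemClass.coe_mul, MulMemClass.coe_mul, coe_sec, coe_sec,
          coe_sec, coe_elemY_pow, coe_elemH_pow, X_pow_mul_monomial, monomial_mul_monomial,
          frac_mul, one_mul, mul_add, mul_one, ← map_add, ← frac_locEq_pow_mul α _ m 1, pow_one,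
          add_comm 1 m, ← frac_add, add_comm (locEq α * _), modByMonic_add_div]
      rw [key]
      exact add_mem (hYp _ _ (ih _ _)) (hHp _ _ (h1 _ _ hr))
  have htop : M = ⊤ := top_unique fun F _ =>
    sec_induction hn hα (P := (· ∈ M)) (fun _ _ => add_mem) hY hsec F
  exact ⟨⟨((Set.finite_range e).insert 1).toFinset, by rw [Set.Finite.coe_toFinset]; exact htop⟩⟩

theorem ringKrullDim_fracRing (hn : 0 < n) (hk : 0 < k) (hα : Function.Injective α)
    (hα0 : ∀ i, α i ≠ 0) : ringKrullDim (fracRing n α) = 2 := by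
  refine le_antisymm ?_ ?_
  · let _ : Algebra (MvPolynomial (Fin 2) K) (fracRing n α) :=
      (MvPolynomial.aeval (R := K) ![elemY hn hα, elemH hn hα]).toRingHom.toAlgebra
    have : Module.Finite (MvPolynomial (Fin 2) K) (fracRing n α) :=
      finite_aeval_elemY_elemH hn hk hα
    refine (ringKrullDim_le_of_isIntegral (MvPolynomial (Fin 2) K) (fracRing n α)).trans ?_
    rw [MvPolynomial.ringKrullDim_of_isNoetherianRing, ringKrullDim_eq_zero_of_field]
    simp
  · -- project `R / YR` onto the coordinate ring `K[A₁]` of one of its components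
    let j : Fin k := ⟨0, hk⟩
    classical
    let θ : MvPolynomial (Fin k) K →ₐ[K] K[X] :=
      MvPolynomial.aeval fun i => if i = j then X else 0
    have hθ : ∀ f ∈ MvPolynomial.crossIdeal (Fin k) K, θ f = 0 := by
      intro f hf
      have hle : MvPolynomial.crossIdeal (Fin k) K ≤ RingHom.ker θ := by
        rw [Ideal.span_le]
        rintro _ ⟨a, b, hab, rfl⟩
        rw [SetLike.mem_coe, RingHom.mem_ker, map_mul, MvPolynomial.aeval_X, MvPolynomial.aeval_X]
        by_cases ha : a = j
        · rw [if_neg (c := b = j) (fun hb => hab (ha.trans hb.symm)), mul_zero]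
        · rw [if_neg ha, zero_mul]
      exact hle hf
    have hθs : Function.Surjective θ := fun q => ⟨aeval (MvPolynomial.X j) q, by
      rw [← aeval_algHom_apply, MvPolynomial.aeval_X, if_pos rfl, aeval_X_left_apply]⟩
    let f : fracRing n α →+* K[X] := (Ideal.Quotient.lift _ θ.toRingHom hθ).comp
      ((quotientEquiv hn hα hα0).toRingEquiv.toRingHom.comp
        (Ideal.Quotient.mk (Ideal.span {elemY hn hα})))
    have hsurj : Function.Surjective f :=
      (Ideal.Quotient.lift_surjective_of_surjective _ hθ hθs).comp
        ((quotientEquiv hn hα hα0).surjective.comp Ideal.Quotient.mk_surjective)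
    have hY0 : f (elemY hn hα) = 0 := by
      change Ideal.Quotient.lift _ θ.toRingHom hθ (quotientEquiv hn hα hα0
        (Ideal.Quotient.mk (Ideal.span {elemY hn hα}) (elemY hn hα))) = 0
      rw [Ideal.Quotient.eq_zero_iff_mem.2 (Ideal.mem_span_singleton_self _), map_zero,
        map_zero]
    have := ringKrullDim_succ_le_of_surjective f hsurj
      (mem_nonZeroDivisors_of_ne_zero (elemY_ne_zero hn hα)) hY0
    rwa [Polynomial.ringKrullDim_of_isNoetherianRing, ringKrullDim_eq_zero_of_field, zero_add,
      one_add_one_eq_two] at this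

end ProjLine

/-! ### Failure of F-purity -/

/-- In an F-pure ring `z ^ p ∈ J^{[p]}` implies `z ∈ J`: apply the definition to `M = R / J`. -/
lemma IsFPure.mem_of_pow_mem_map_frobenius {p : ℕ} {R : Type u} [CommRing R] [ExpChar R p]
    (h : IsFPure p R) {J : Ideal R} {z : R} (hz : z ^ p ∈ J.map (frobenius R p)) : z ∈ J := by
  let ι : R → FrobeniusAlg p R := id
  have hι : ∀ (r : R) (s : FrobeniusAlg p R), r • s = ι (r ^ p) * s := fun r s => rfl
  let o : R ⧸ J := Ideal.Quotient.mk J 1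
  have ho : ∀ r : R, r • o = Ideal.Quotient.mk J r := fun r => by
    rw [Algebra.smul_def, Ideal.Quotient.algebraMap_eq, ← map_mul, mul_one]
  have hpow : ∀ r : R, ι (r ^ p) ⊗ₜ[R] o = (1 : FrobeniusAlg p R) ⊗ₜ[R] Ideal.Quotient.mk J r := by
    intro r
    have : ι (r ^ p) = r • (1 : FrobeniusAlg p R) := by rw [hι, mul_one]
    rw [this, TensorProduct.smul_tmul, ho]
  have hzero : ∀ s ∈ J.map (frobenius R p), ι s ⊗ₜ[R] o = 0 := by
    intro s hs
    refine Submodule.span_induction (p := fun s _ => ι s ⊗ₜ[R] o = 0) ?_ ?_ ?_ ?_ hs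
    · rintro _ ⟨j, hj, rfl⟩
      rw [frobenius_def, hpow, Ideal.Quotient.eq_zero_iff_mem.2 hj, TensorProduct.tmul_zero]
    · exact TensorProduct.zero_tmul _ _
    · intro s t _ _ hs ht
      have : ι (s + t) = ι s + ι t := rfl
      rw [this, TensorProduct.add_tmul, hs, ht, add_zero]
    · intro a s _ hs
      have : ι (a • s) ⊗ₜ[R] o = ι a • (ι s ⊗ₜ[R] o) := rfl
      rw [this, hs, smul_zero]
  have h0 := (hpow z).symm.trans (hzero _ hz)
  have := h (R ⧸ J) (a₁ := Ideal.Quotient.mk J z) (a₂ := 0) (by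
    change _ = (1 : FrobeniusAlg p R) ⊗ₜ[R] (0 : R ⧸ J)
    rw [TensorProduct.tmul_zero]; exact h0)
  exact Ideal.Quotient.eq_zero_iff_mem.1 this

namespace ProjLine

open Polynomial

variable {K : Type u} [Field K] {n k : ℕ} {α : Fin k → K}

/-- The ideal generated by the elements `(xᵃ / g) Tⁿ`, `a ≤ k - 2`, that is, the ideal of the
elements vanishing to order two at infinity. Up to a shift it is the canonical module of the
section ring. -/
noncomputable def canonicalIdeal (hn : 0 < n) (hα : Function.Injective α) :
    Ideal (fracRing n α) :=
  Ideal.span (Set.range fun a : Fin (k - 1) => sec hn hα n 1 (X ^ (a : ℕ)) (by simp)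
    (by rw [natDegree_X_pow]; omega))

lemma coeff_of_mem_canonicalIdeal (hn : 0 < n) (hα : Function.Injective α) {b : fracRing n α}
    (hb : b ∈ canonicalIdeal hn hα) (i : ℕ) :
    ∃ f ∈ degreeLT K (k * (i / n) - 1), (b : (RatFunc K)[X]).coeff i = frac α f (i / n) := by
  obtain ⟨r, rfl⟩ := Ideal.mem_span_range_iff_exists_fun.1 hb
  rw [AddSubmonoidClass.coe_finsetSum, finsetSum_coeff]
  refine Finset.sum_induction _ (fun φ => ∃ f ∈ degreeLT K (k * (i / n) - 1), φ = frac α f (i / n))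
    ?_ ⟨0, zero_mem _, (frac_zero _ _).symm⟩ fun a _ => ?_
  · rintro _ _ ⟨f, hf, rfl⟩ ⟨f', hf', rfl⟩
    exact ⟨f + f', add_mem hf hf', (frac_add _ _ _ _).symm⟩
  · rw [MulMemClass.coe_mul, coe_sec]
    rcases lt_or_ge i n with hi | hi
    · refine ⟨0, zero_mem _, ?_⟩
      rw [frac_zero, ← C_mul_X_pow_eq_monomial, ← mul_assoc, coeff_mul_X_pow', if_neg (by omega)]
    · obtain ⟨d, rfl⟩ := Nat.exists_eq_add_of_le' hi
      obtain ⟨f, hf, h⟩ := exists_coeff_eq hα (r a) d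
      rw [coeff_mul_monomial, h, frac_mul, Nat.add_div_right _ hn]
      refine ⟨_, mem_degreeLT.2 ?_, rfl⟩
      refine degree_le_natDegree.trans_lt (Nat.cast_lt.2 ?_)
      have h1 : (f * X ^ (a : ℕ)).natDegree ≤ f.natDegree + a :=
        natDegree_mul_le.trans (by rw [natDegree_X_pow])
      rw [mul_add]
      omega

/-- The elements `(f / g ^ e) T ^ (n e)`, where `e = p + d` is large compared with `deg f`, are
combinations of `p`-th powers of generators of the canonical ideal. -/
lemma sec_mem_map_frobenius_canonicalIdeal (p : ℕ) [ExpChar (fracRing n α) p] (hp : 0 < p)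
    (hn : 0 < n) (hk : 2 ≤ k) (hα : Function.Injective α) {d : ℕ} (hd : p - 1 ≤ k * d) (f : K[X])
    (hf : f.natDegree ≤ (k - 2) * p + k * d) (h2 : f.natDegree ≤ k * (p + d)) :
    sec hn hα (n * (p + d)) (p + d) f le_rfl h2 ∈
      (canonicalIdeal hn hα).map (frobenius (fracRing n α) p) := by
  set I := (canonicalIdeal hn hα).map (frobenius (fracRing n α) p)
  suffices h : ∃ G ∈ I, (G : (RatFunc K)[X]) = monomial (n * (p + d)) (frac α f (p + d)) by
    obtain ⟨G, hG, h⟩ := h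
    have : sec hn hα (n * (p + d)) (p + d) f le_rfl h2 = G := Subtype.ext h.symm
    rwa [this]
  clear h2
  refine induction_with_natDegree_le
    (fun f => ∃ G ∈ I, (G : (RatFunc K)[X]) = monomial (n * (p + d)) (frac α f (p + d)))
    ((k - 2) * p + k * d) ⟨0, zero_mem _, ?_⟩ ?_ ?_ f hf
  · rw [frac_zero, monomial_zero_right]; rfl
  · intro i c _ hi
    -- write `i = a p + j` with `a ≤ k - 2` and `j ≤ k d`
    obtain ⟨a, j, ha, hj, rfl⟩ : ∃ a j, a ≤ k - 2 ∧ j ≤ k * d ∧ i = a * p + j := by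
      rcases le_or_gt (i / p) (k - 2) with h | h
      · refine ⟨i / p, i % p, h, ?_, ?_⟩
        · have := Nat.mod_lt i hp
          omega
        · rw [mul_comm]; exact (Nat.div_add_mod i p).symm
      · have h1 : (k - 2) * p ≤ i := (Nat.le_div_iff_mul_le hp).1 h.le
        exact ⟨k - 2, i - (k - 2) * p, le_rfl, by omega, by omega⟩
    let w : fracRing n α := sec hn hα n 1 (X ^ a) (by simp) (by rw [natDegree_X_pow]; omega)
    have hw : w ∈ canonicalIdeal hn hα := Ideal.subset_span ⟨⟨a, by omega⟩, rfl⟩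
    let s : fracRing n α := sec hn hα (n * d) d (C c * X ^ j) le_rfl
      ((natDegree_C_mul_X_pow_le _ _).trans hj)
    refine ⟨s * frobenius _ p w, I.mul_mem_left _ (Ideal.mem_map_of_mem _ hw), ?_⟩
    rw [frobenius_def, MulMemClass.coe_mul, SubmonoidClass.coe_pow, coe_sec, coe_sec, monomial_pow,
      monomial_mul_monomial, frac_pow, frac_mul, one_mul, mul_add, add_comm (n * d), add_comm d,
      mul_assoc, ← pow_mul, ← pow_add, add_comm j]
  · rintro f f' _ _ ⟨G, hG, h⟩ ⟨G', hG', h'⟩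
    exact ⟨G + G', add_mem hG hG', by rw [AddMemClass.coe_add, h, h', frac_add, map_add]⟩

/-- The section ring is not F-pure when `1 / n + 2 / k < 1`, which is the inequality `hnk`.
The `ℚ`-divisor `K_{ℙ¹} + ∑ (1 - 1/n) Pᵢ` then has positive degree, and its `p`-fold multiple rounds
down to a divisor of degree at least `-1`, whose `H¹` vanishes; so Frobenius kills the socle of the
top local cohomology of the canonical module. Concretely, with `ω` the canonical ideal,
`z = Yⁿ x ^ (k - 1) h²` is not in `J = (Y ^ (n + 1), h) ω` while `z ^ p ∈ J^{[p]}`. -/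
theorem not_isFPure_fracRing (p : ℕ) [Fact p.Prime] [CharP K p] (hn : 0 < n)
    (hα : Function.Injective α) (hnk : k + 2 * n < n * k) : ¬ IsFPure p (fracRing n α) := by
  intro hF
  have hp2 : 2 ≤ p := (Fact.out : p.Prime).two_le
  have hk : 3 ≤ k := by
    by_contra! h
    have : n * k ≤ n * 2 := Nat.mul_le_mul_left _ (by omega)
    omega
  set I₁ : Ideal (fracRing n α) := Ideal.span {elemY hn hα ^ (n + 1), elemH hn hα}
  set ω := canonicalIdeal hn hα
  have hdeg : (X ^ (k - 1) : K[X]).natDegree ≤ k * 2 := by rw [natDegree_X_pow]; omega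
  set z : fracRing n α := elemY hn hα ^ n * sec hn hα (n * 2) 2 (X ^ (k - 1)) le_rfl hdeg
  have hz : z ∉ I₁ * ω := by
    intro hz
    have key : ∀ F ∈ I₁ * ω, ∃ f₁ ∈ degreeLT K (k * 1 - 1), ∃ f₂ ∈ degreeLT K (k * 2 - 1),
        (F : (RatFunc K)[X]).coeff (3 * n) = frac α (locEq α ^ 2 * f₁ + f₂) 3 := by
      intro F hF
      refine Submodule.mul_induction_on hF ?_ ?_
      · intro a ha b hb
        obtain ⟨r, s, rfl⟩ := Ideal.mem_span_pair.1 ha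
        obtain ⟨f₁, hf₁, h₁⟩ := coeff_of_mem_canonicalIdeal hn hα (ω.mul_mem_left r hb) (2 * n - 1)
        obtain ⟨f₂, hf₂, h₂⟩ := coeff_of_mem_canonicalIdeal hn hα (ω.mul_mem_left s hb) (n * 2)
        have e1 : (2 * n - 1) / n = 1 :=
          Nat.div_eq_of_lt_le (by omega) (by omega)
        rw [e1] at hf₁ h₁
        rw [Nat.mul_div_cancel_left _ hn] at hf₂ h₂
        refine ⟨f₁, hf₁, f₂, hf₂, ?_⟩
        have e2 : (r * elemY hn hα ^ (n + 1) + s * elemH hn hα) * b =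
          (r * b) * elemY hn hα ^ (n + 1) + (s * b) * elemH hn hα := by ring
        have e3 : 3 * n = (2 * n - 1) + (n + 1) := by omega
        have e4 : 3 * n = n * 2 + n := by omega
        rw [e2]
        generalize r * b = rb at h₁ ⊢
        generalize s * b = sb at h₂ ⊢
        rw [AddMemClass.coe_add, coeff_add, MulMemClass.coe_mul, coe_elemY_pow,
          MulMemClass.coe_mul, coe_elemH, frac_add]
        congr 1
        · rw [e3, coeff_mul_X_pow, h₁]
          exact (frac_locEq_pow_mul α f₁ 1 2).symm
        · rw [e4, coeff_mul_monomial, h₂, frac_mul, mul_one]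
      · rintro F G ⟨f₁, hf₁, f₂, hf₂, h⟩ ⟨f₁', hf₁', f₂', hf₂', h'⟩
        refine ⟨f₁ + f₁', add_mem hf₁ hf₁', f₂ + f₂', add_mem hf₂ hf₂', ?_⟩
        rw [AddMemClass.coe_add, coeff_add, h, h', ← frac_add]
        congr 1
        ring
    obtain ⟨f₁, -, f₂, hf₂, h⟩ := key z hz
    have hzc : (z : (RatFunc K)[X]).coeff (3 * n) = frac α (locEq α ^ 1 * X ^ (k - 1)) (1 + 2) := by
      rw [MulMemClass.coe_mul, coe_elemY_pow, coe_sec, X_pow_mul_monomial, frac_locEq_pow_mul,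
        show 3 * n = n * 2 + n by ring, coeff_monomial_same]
    rw [hzc, frac_inj] at h
    -- compare degrees in `f₂ = g (x ^ (k - 1) - g f₁)`
    have h' : f₂ = locEq α * (X ^ (k - 1) - locEq α * f₁) := by
      linear_combination -h
    have hq : k - 1 ≤ (X ^ (k - 1) - locEq α * f₁).natDegree ∧
        X ^ (k - 1) - locEq α * f₁ ≠ 0 := by
      by_cases h0 : f₁ = 0
      · rw [h0, mul_zero, sub_zero, natDegree_X_pow]
        exact ⟨le_rfl, pow_ne_zero _ X_ne_zero⟩
      · have h1 : k ≤ (locEq α * f₁).natDegree := by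
          rw [(locEq_monic α).natDegree_mul' h0, natDegree_locEq]; omega
        have h2 : (X ^ (k - 1) - locEq α * f₁).natDegree = (locEq α * f₁).natDegree :=
          natDegree_sub_eq_right_of_natDegree_lt (by rw [natDegree_X_pow]; omega)
        refine ⟨by omega, fun h3 => ?_⟩
        rw [h3, natDegree_zero] at h2
        omega
    have hf₂0 : f₂ ≠ 0 := by
      rw [h']; exact mul_ne_zero (locEq_monic α).ne_zero hq.2
    have hlt := (natDegree_lt_iff_degree_lt hf₂0).2 (mem_degreeLT.1 hf₂)
    rw [h', (locEq_monic α).natDegree_mul' hq.2, natDegree_locEq] at hlt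
    omega
  refine hz (hF.mem_of_pow_mem_map_frobenius ?_)
  rw [Ideal.map_mul]
  -- divide `x ^ (p (k - 1))` by `g ^ c` with `c = ⌈p / n⌉`
  obtain ⟨c, hc1, hc2⟩ : ∃ c, p ≤ n * c ∧ n * c ≤ p + (n - 1) := by
    refine ⟨(p + (n - 1)) / n, ?_, Nat.mul_div_le _ _⟩
    have := Nat.div_add_mod (p + (n - 1)) n
    have := Nat.mod_lt (p + (n - 1)) hn
    omega
  have hn2 : 2 ≤ n := by
    by_contra! h
    have : n = 1 := by omega
    subst this
    omega
  have hcp : c ≤ p := by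
    by_contra! h
    have h1 : n * (p + 1) ≤ n * c := Nat.mul_le_mul_left _ h
    have h2 : 2 * p ≤ n * p := Nat.mul_le_mul_right _ hn2
    rw [mul_add] at h1
    omega
  obtain ⟨d, hpd⟩ := Nat.exists_eq_add_of_le hcp
  -- `k d - 2 p ≥ -1` is the degree of the `p`-fold multiple, rounded down
  have hd : 2 * p - 1 ≤ k * d := by
    have h1 : 2 * (p - 1) < k * d := by
      obtain ⟨q, hq⟩ : ∃ q, p = q + 1 := ⟨p - 1, by omega⟩
      obtain ⟨l, rfl⟩ : ∃ l, n = l + 1 := ⟨n - 1, by omega⟩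
      have h2 : l * q ≤ (l + 1) * d := by
        have : (l + 1) * c + (l + 1) * d = (l + 1) * (q + 1) := by rw [← mul_add, ← hpd, hq]
        have h3 : (l + 1) * (q + 1) = l * q + l + q + 1 := by ring
        omega
      have h3 : 2 * (l + 1) + 1 ≤ l * k := by
        have : (l + 1) * k = l * k + k := by ring
        omega
      have h4 : (2 * (l + 1) + 1) * q ≤ l * k * q := Nat.mul_le_mul_right _ h3
      have h5 : k * (l * q) ≤ k * ((l + 1) * d) := Nat.mul_le_mul_left _ h2
      have h6 : (l + 1) * (2 * q) < (l + 1) * (k * d) := by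
        have : 1 ≤ q := by omega
        nlinarith
      have := lt_of_mul_lt_mul_left h6 (Nat.zero_le _)
      rw [hq]
      simpa using this
    omega
  have hkp : k * p = k * c + k * d := by rw [← mul_add, ← hpd]
  have hk1 : (k - 1) * p = k * p - p := by rw [Nat.sub_mul, one_mul]
  have hk2 : (k - 2) * p = k * p - 2 * p := by rw [Nat.sub_mul]
  have hc0 : 0 < k * c := by
    refine Nat.mul_pos (by omega) (Nat.pos_of_ne_zero ?_)
    rintro rfl
    omega
  have hgc : (locEq α ^ c).Monic := (locEq_monic α).pow c
  set a := (X ^ ((k - 1) * p) : K[X]) /ₘ locEq α ^ c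
  set b := (X ^ ((k - 1) * p) : K[X]) %ₘ locEq α ^ c
  have hab : b + locEq α ^ c * a = X ^ ((k - 1) * p) := modByMonic_add_div _ _
  have ha : a.natDegree ≤ (k - 2) * p + k * d := by
    rw [natDegree_divByMonic _ hgc, natDegree_X_pow, natDegree_locEq_pow]
    omega
  have hb : (locEq α ^ p * b).natDegree ≤ (k - 2) * p + k * p := by
    have h1 : b.natDegree < k * c := by
      rw [← natDegree_locEq_pow α c]
      refine natDegree_modByMonic_lt _ hgc fun h1 => ?_
      have := natDegree_locEq_pow α c
      rw [h1, natDegree_one] at this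
      omega
    refine natDegree_mul_le.trans ?_
    rw [natDegree_locEq_pow]
    omega
  have ha' : a.natDegree ≤ k * (p + d) := ha.trans (by rw [mul_add]; omega)
  have hb' : (locEq α ^ p * b).natDegree ≤ k * (p + p) := hb.trans (by rw [mul_add]; omega)
  have hmema := sec_mem_map_frobenius_canonicalIdeal p (by omega) hn (by omega) hα
    (by omega) a ha ha'
  have hmemb := sec_mem_map_frobenius_canonicalIdeal p (by omega) hn (by omega) hα
    (by omega) _ hb hb'
  have hzp : z ^ p = (elemY hn hα ^ (n + 1)) ^ p *
      (elemY hn hα ^ (n * c - p) * sec hn hα (n * (p + d)) (p + d) a le_rfl ha') +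
      elemH hn hα ^ p * sec hn hα (n * (p + p)) (p + p) (locEq α ^ p * b) le_rfl hb' := by
    refine Subtype.ext ?_
    have e1 : (n + 1) * p + (n * c - p) + n * (p + d) = n * (3 * p) := by
      have : n * p = n * c + n * d := by rw [← mul_add, ← hpd]
      rw [add_mul, mul_add, show n * (3 * p) = 3 * (n * p) by ring]
      omega
    have e2 : 3 * p = (p + c) + (p + d) := by omega
    rw [SubmonoidClass.coe_pow, AddMemClass.coe_add, MulMemClass.coe_mul, MulMemClass.coe_mul,
      MulMemClass.coe_mul, MulMemClass.coe_mul, ← pow_mul, coe_elemY_pow, coe_elemY_pow,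
      coe_elemY_pow, coe_elemH_pow, coe_sec, coe_sec, coe_sec, ← mul_assoc, ← pow_add,
      X_pow_mul_monomial, X_pow_mul_monomial, monomial_mul_monomial, frac_mul, one_mul,
      monomial_pow, frac_pow, add_comm (n * (p + d)), e1, ← mul_add,
      show p + (p + p) = 3 * p by ring, show (n * 2 + n) * p = n * (3 * p) by ring, ← map_add,
      ← frac_locEq_pow_mul α a (p + d) (p + c), ← e2, ← frac_add, ← pow_mul, ← hab,
      ← frac_locEq_pow_mul α _ (2 * p) p, show p + 2 * p = 3 * p by ring]
    congr 2
    ring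
  rw [hzp]
  refine add_mem (Ideal.mul_mem_mul ?_ (Ideal.mul_mem_left _ _ hmema)) (Ideal.mul_mem_mul ?_ hmemb)
  · exact Ideal.mem_map_of_mem (frobenius _ p) (Ideal.subset_span (Set.mem_insert _ _))
  · exact Ideal.mem_map_of_mem (frobenius _ p)
      (Ideal.subset_span (Set.mem_insert_of_mem _ rfl))

end ProjLine

/-! ### Tight closure of one- and two-generated ideals in domains -/

section TightClosure

variable {R : Type*} [CommRing R]

/-- In a Noetherian normal domain principal ideals are tightly closed: if `c z^q ∈ (x^q)` for
`q ≫ 0`, then the `R`-module generated by the powers `(z / x) ^ q` embeds in `c⁻¹ R`, so it is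
finitely generated, and `z / x` is integral over `R`. -/
lemma mem_span_singleton_of_forall_pow [IsDomain R] [IsNoetherianRing R] [IsIntegrallyClosed R]
    {p : ℕ} (hp : 1 < p) {c z x : R} (hc : c ≠ 0) {e₀ : ℕ}
    (h : ∀ e ≥ e₀, c * z ^ p ^ e ∈ Ideal.span {x ^ p ^ e}) : z ∈ Ideal.span {x} := by
  have hp0 : ∀ e, p ^ e ≠ 0 := fun e => pow_ne_zero _ (by omega)
  by_cases hx : x = 0
  · have := h e₀ le_rfl
    rw [hx, zero_pow (hp0 _), Ideal.mem_span_singleton, zero_dvd_iff] at this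
    rw [hx, eq_zero_of_pow_eq_zero ((mul_eq_zero.1 this).resolve_left hc)]
    exact zero_mem _
  let F := FractionRing R
  have hinj : Function.Injective (algebraMap R F) := IsFractionRing.injective R F
  have hxF : algebraMap R F x ≠ 0 := (map_ne_zero_iff _ hinj).2 hx
  have hcF : algebraMap R F c ≠ 0 := (map_ne_zero_iff _ hinj).2 hc
  let φ : F := algebraMap R F z / algebraMap R F x
  have ha : ∀ i, ∃ a, algebraMap R F a = algebraMap R F c * φ ^ p ^ (e₀ + i) := by
    intro i
    obtain ⟨a, ha⟩ := Ideal.mem_span_singleton.1 (h (e₀ + i) (Nat.le_add_right _ _))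
    refine ⟨a, ?_⟩
    have := congrArg (algebraMap R F) ha
    rw [map_mul, map_mul, map_pow, map_pow] at this
    rw [div_pow, mul_div_assoc', this, mul_div_cancel_left₀ _ (pow_ne_zero _ hxF)]
  choose a ha using ha
  let J : ℕ →o Ideal R := ⟨fun N => Ideal.span (Set.range fun i : Fin N => a i), fun N M hNM =>
    Ideal.span_mono (by
      rintro _ ⟨i, rfl⟩
      exact ⟨⟨i, i.2.trans_le hNM⟩, rfl⟩)⟩
  obtain ⟨N, hN⟩ := (monotone_stabilizes_iff_noetherian (R := R) (M := R)).2 inferInstance J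
  have haN : a N ∈ J N := by
    rw [hN (N + 1) (Nat.le_succ N)]
    exact Ideal.subset_span ⟨⟨N, Nat.lt_succ_self N⟩, rfl⟩
  obtain ⟨r, hr⟩ := Ideal.mem_span_range_iff_exists_fun.1 haN
  have hint : IsIntegral R φ := by
    let P : R[X] := ∑ i : Fin N, Polynomial.C (r i) * Polynomial.X ^ p ^ (e₀ + i)
    refine ⟨Polynomial.X ^ p ^ (e₀ + N) - P, Polynomial.monic_X_pow_sub ?_, ?_⟩
    · refine (Polynomial.degree_sum_le _ _).trans_lt
        ((Finset.sup_lt_iff (WithBot.bot_lt_coe _)).2 fun i _ => ?_)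
      refine (Polynomial.degree_C_mul_X_pow_le _ _).trans_lt (Nat.cast_lt.2 ?_)
      exact Nat.pow_lt_pow_right hp (by omega)
    · have h1 := congrArg (algebraMap R F) hr
      rw [map_sum, ha] at h1
      simp only [map_mul, ha] at h1
      rw [← Polynomial.aeval_def, map_sub, map_sum, map_pow, Polynomial.aeval_X, sub_eq_zero]
      refine mul_left_cancel₀ hcF ?_
      rw [← h1, Finset.mul_sum]
      refine Finset.sum_congr rfl fun i _ => ?_
      rw [map_mul, Polynomial.aeval_C, map_pow, Polynomial.aeval_X]
      ring
  obtain ⟨y, hy⟩ := IsIntegrallyClosed.isIntegral_iff.1 hint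
  refine Ideal.mem_span_singleton.2 ⟨y, hinj ?_⟩
  rw [map_mul, hy, mul_div_cancel₀ _ hxF]

/-- Multiplication by `b` is injective modulo `a`. -/
def RegularPair (a b : R) : Prop := ∀ r, a ∣ b * r → a ∣ r

lemma RegularPair.pow_right {a b : R} (h : RegularPair a b) (j : ℕ) : RegularPair a (b ^ j) := by
  induction j with
  | zero => intro r hr; simpa using hr
  | succ j ih => intro r hr; rw [pow_succ', mul_assoc] at hr; exact ih r (h _ hr)

lemma RegularPair.pow_left [IsDomain R] {a b : R} (h : RegularPair a b) (i : ℕ) :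
    RegularPair (a ^ i) b := by
  by_cases ha : a = 0
  · subst ha
    rcases i with _ | i
    · intro r _; simp
    · rwa [zero_pow (by omega)]
  induction i with
  | zero => intro r _; simp
  | succ i ih =>
    intro r hr
    obtain ⟨r', rfl⟩ := h r ((dvd_pow_self a (by omega)).trans hr)
    rw [pow_succ'] at hr ⊢
    refine mul_dvd_mul_left a (ih r' ((mul_dvd_mul_iff_left ha).1 ?_))
    rwa [mul_left_comm] at hr

lemma RegularPair.pow [IsDomain R] {a b : R} (h : RegularPair a b) (i j : ℕ) :
    RegularPair (a ^ i) (b ^ j) := (h.pow_left i).pow_right j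

lemma RegularPair.symm [IsDomain R] {a b : R} (h : RegularPair a b) (ha : a ≠ 0) :
    RegularPair b a := by
  rintro r ⟨w, hw⟩
  obtain ⟨w', rfl⟩ := h w ⟨r, hw.symm⟩
  refine ⟨w', mul_left_cancel₀ ha ?_⟩
  rw [hw]
  ring

/-- Linkage: for a regular pair `u, v` in the ideal `(x, y)`, written `u = a x + b y` and
`v = c x + d y`, one has `(u, v) : (a d - b c) ⊆ (x, y)`. -/
lemma mem_span_pair_of_det_mul_mem [IsDomain R] {x y a b c d z : R} (hx : x ≠ 0)
    (hu : a * x + b * y ≠ 0) (h : RegularPair (a * x + b * y) (c * x + d * y))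
    (hz : (a * d - b * c) * z ∈ Ideal.span {a * x + b * y, c * x + d * y}) :
    z ∈ Ideal.span {x, y} := by
  obtain ⟨s, t, hst⟩ := Ideal.mem_span_pair.1 hz
  set u := a * x + b * y with hu'
  set v := c * x + d * y with hv'
  -- Cramer's rule, multiplied by `x`
  have h1 : v * (z * b + x * t) = u * (z * d - x * s) := by
    linear_combination x * hst - z * (d * hu' - b * hv')
  obtain ⟨w, hw⟩ := h _ ⟨_, h1⟩
  have hw2 : z * d - x * s = v * w := by
    refine mul_left_cancel₀ hu ?_
    rw [← h1, hw]
    ring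
  -- modulo `x`, the element `z - y w` is killed by the regular pair `u, v`
  have h2 : u * (z - y * w) = x * (a * (z - y * w) + y * (a * w - t)) := by
    linear_combination (z - y * w) * hu' + y * (hw + hu' * w)
  have h3 : v * (z - y * w) = x * (c * (z - y * w) + y * (s + c * w)) := by
    linear_combination (z - y * w) * hv' + y * (hw2 + hv' * w)
  set z' := z - y * w with hz'
  have h4 : v * (a * z' + y * (a * w - t)) = u * (c * z' + y * (s + c * w)) := by
    refine mul_left_cancel₀ hx ?_
    linear_combination (-v) * h2 + u * h3
  obtain ⟨w', hw'⟩ := h _ ⟨_, h4⟩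
  have h5 : z' = x * w' := by
    refine mul_left_cancel₀ hu ?_
    rw [h2, hw']
    ring
  rw [show z = w' * x + w * y by linear_combination h5]
  exact Ideal.mem_span_pair.2 ⟨w', w, rfl⟩

/-- The ideal `(u, v)` of a domain is tightly closed: `c z^q ∈ (u^q, v^q)` for some `c ≠ 0` and all
`q = p ^ e ≫ 0` implies `z ∈ (u, v)`. -/
def TightPair (p : ℕ) (u v : R) : Prop :=
  ∀ z c : R, c ≠ 0 → ∀ e₀ : ℕ, (∀ e ≥ e₀, c * z ^ p ^ e ∈ Ideal.span {u ^ p ^ e, v ^ p ^ e}) →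
    z ∈ Ideal.span {u, v}

lemma TightPair.symm {p : ℕ} {u v : R} (h : TightPair p u v) : TightPair p v u := by
  intro z c hc e₀ he
  rw [Set.pair_comm]
  refine h z c hc e₀ fun e hee => ?_
  rw [Set.pair_comm]
  exact he e hee

lemma tightPair_one (p : ℕ) (v : R) : TightPair p 1 v := by
  intro z _ _ _ _
  have : (1 : R) ∈ Ideal.span {1, v} := Ideal.subset_span (Set.mem_insert _ _)
  rw [(Ideal.eq_top_iff_one _).2 this]
  trivial

lemma TightPair.mul [IsDomain R] {p : ℕ} [ExpChar R p] {u u' v : R} (h : TightPair p u v)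
    (h' : TightPair p u' v) (hv : RegularPair v u) : TightPair p (u * u') v := by
  intro z c hc e₀ he
  obtain ⟨z', s, hz⟩ := Ideal.mem_span_pair.1 (h z c hc e₀ fun e hee => by
    obtain ⟨r, t, hrt⟩ := Ideal.mem_span_pair.1 (he e hee)
    exact Ideal.mem_span_pair.2 ⟨r * u' ^ p ^ e, t, by rw [← hrt]; ring⟩)
  by_cases hu : u = 0
  · subst hu
    rw [zero_mul]
    exact Ideal.mem_span_pair.2 ⟨z', s, hz⟩
  have hz' : z' ∈ Ideal.span {u', v} := by
    refine h' z' c hc e₀ fun e hee => ?_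
    obtain ⟨r, t, hrt⟩ := Ideal.mem_span_pair.1 (he e hee)
    have e1 : u ^ p ^ e * (c * z' ^ p ^ e - r * u' ^ p ^ e) =
        v ^ p ^ e * (t - c * s ^ p ^ e) := by
      rw [← hz, add_pow_expChar_pow] at hrt
      linear_combination -hrt
    obtain ⟨w, hw⟩ := hv.pow (p ^ e) (p ^ e) _ ⟨_, e1⟩
    exact Ideal.mem_span_pair.2 ⟨r, w, by linear_combination -hw⟩
  obtain ⟨r, t, hrt⟩ := Ideal.mem_span_pair.1 hz'
  exact Ideal.mem_span_pair.2 ⟨r, t * u + s, by linear_combination u * hrt + hz⟩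

lemma TightPair.pow [IsDomain R] {p : ℕ} [ExpChar R p] {u v : R} (h : TightPair p u v)
    (huv : RegularPair u v) (hu : u ≠ 0) (i j : ℕ) :
    TightPair p (u ^ i) (v ^ j) := by
  have hi : TightPair p (u ^ i) v := by
    induction i with
    | zero => rw [pow_zero]; exact tightPair_one _ _
    | succ i ih => rw [pow_succ']; exact h.mul ih (huv.symm hu)
  induction j with
  | zero => rw [pow_zero]; exact (tightPair_one _ _).symm
  | succ j ih =>
    rw [pow_succ']
    exact (hi.symm.mul ih.symm (huv.pow_left i)).symm

/-- If a regular pair `u, v` in `(x, y)` generates a tightly closed ideal, so does `x, y`. -/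
lemma TightPair.of_regularPair [IsDomain R] {p : ℕ} [ExpChar R p] {x y u v : R} (hx : x ≠ 0)
    (hu0 : u ≠ 0) (huv : RegularPair u v) (hu : u ∈ Ideal.span {x, y})
    (hv : v ∈ Ideal.span {x, y}) (h : TightPair p u v) : TightPair p x y := by
  intro z c hc e₀ he
  obtain ⟨a, b, rfl⟩ := Ideal.mem_span_pair.1 hu
  obtain ⟨c', d, rfl⟩ := Ideal.mem_span_pair.1 hv
  refine mem_span_pair_of_det_mul_mem hx hu0 huv (h _ c hc e₀ fun e hee => ?_)
  obtain ⟨r, s, hrs⟩ := Ideal.mem_span_pair.1 (he e hee)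
  refine Ideal.mem_span_pair.2 ⟨r * d ^ p ^ e - s * c' ^ p ^ e, s * a ^ p ^ e - r * b ^ p ^ e, ?_⟩
  rw [mul_pow, sub_pow_expChar_pow, add_pow_expChar_pow, add_pow_expChar_pow]
  simp only [mul_pow]
  linear_combination (a ^ p ^ e * d ^ p ^ e - b ^ p ^ e * c' ^ p ^ e) * hrs

end TightClosure

namespace ProjLine

open Polynomial

variable {K : Type u} [Field K]

/-! ### Leading forms -/

section lead

variable {D : QDivisor K}

/-- The leading form: the homogeneous component of top degree. -/
noncomputable def lead (F : sectionRing D) : sectionRing D :=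
  component D (F : (RatFunc K)[X]).natDegree F

lemma coe_lead (F : sectionRing D) : (lead F : (RatFunc K)[X]) =
    monomial (F : (RatFunc K)[X]).natDegree (F : (RatFunc K)[X]).leadingCoeff := rfl

lemma natDegree_lead (F : sectionRing D) :
    (lead F : (RatFunc K)[X]).natDegree = (F : (RatFunc K)[X]).natDegree := by
  classical
  rw [coe_lead, natDegree_monomial]
  split_ifs with h
  · rw [leadingCoeff_eq_zero.1 h, natDegree_zero]
  · rfl

lemma leadingCoeff_lead (F : sectionRing D) :
    (lead F : (RatFunc K)[X]).leadingCoeff = (F : (RatFunc K)[X]).leadingCoeff := by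
  rw [coe_lead, leadingCoeff_monomial]

lemma coe_lead_eq_of {F G : sectionRing D}
    (h1 : (F : (RatFunc K)[X]).natDegree = (G : (RatFunc K)[X]).natDegree)
    (h2 : (F : (RatFunc K)[X]).leadingCoeff = (G : (RatFunc K)[X]).leadingCoeff) :
    lead F = lead G :=
  Subtype.ext (by rw [coe_lead, coe_lead, h1, h2])

lemma lead_lead (F : sectionRing D) : lead (lead F) = lead F :=
  coe_lead_eq_of (natDegree_lead F) (leadingCoeff_lead F)

lemma lead_eq_zero_iff {F : sectionRing D} : lead F = 0 ↔ F = 0 := by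
  rw [← Subtype.val_inj, ← Subtype.val_inj, coe_lead]
  change _ = 0 ↔ _ = 0
  rw [monomial_eq_zero_iff, leadingCoeff_eq_zero]

lemma lead_mul (F G : sectionRing D) : lead (F * G) = lead F * lead G := by
  by_cases hF : F = 0
  · rw [hF, zero_mul, lead_eq_zero_iff.2 rfl, zero_mul]
  by_cases hG : G = 0
  · rw [hG, mul_zero, lead_eq_zero_iff.2 rfl, mul_zero]
  refine Subtype.ext ?_
  rw [MulMemClass.coe_mul, coe_lead, coe_lead, coe_lead, MulMemClass.coe_mul, leadingCoeff_mul,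
    natDegree_mul, monomial_mul_monomial]
  · exact fun h => hF (Subtype.ext h)
  · exact fun h => hG (Subtype.ext h)

lemma lead_one : lead (1 : sectionRing D) = 1 :=
  Subtype.ext (by rw [coe_lead]; simp)

lemma lead_pow (F : sectionRing D) (j : ℕ) : lead (F ^ j) = lead F ^ j := by
  induction j with
  | zero => rw [pow_zero, pow_zero, lead_one]
  | succ j ih => rw [pow_succ, pow_succ, lead_mul, ih]

lemma degree_eq_of_lead_eq {F G : sectionRing D} (h : lead F = lead G) :
    (F : (RatFunc K)[X]).degree = (G : (RatFunc K)[X]).degree := by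
  have key : ∀ F : sectionRing D, (lead F : (RatFunc K)[X]).degree =
      (F : (RatFunc K)[X]).degree := by
    intro F
    by_cases hF : F = 0
    · rw [hF, lead_eq_zero_iff.2 rfl]
    rw [degree_eq_natDegree fun h => hF (Subtype.ext h), degree_eq_natDegree fun h =>
      hF (lead_eq_zero_iff.1 (Subtype.ext h)), natDegree_lead]
  rw [← key, h, key]

lemma degree_sub_lt_of_lead_eq {F G : sectionRing D} (hF : F ≠ 0) (h : lead F = lead G) :
    ((F - G : sectionRing D) : (RatFunc K)[X]).degree < (F : (RatFunc K)[X]).degree := by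
  refine degree_sub_lt_left (degree_eq_of_lead_eq h) (fun h => hF (Subtype.ext h)) ?_
  rw [← leadingCoeff_lead, h, leadingCoeff_lead]

/-- A pair is regular as soon as the pair of its leading forms is. -/
lemma regularPair_of_lead {u v : sectionRing D} (h : RegularPair (lead u) (lead v)) :
    RegularPair u v := by
  intro r
  induction hd : (r : (RatFunc K)[X]).degree using WellFoundedLT.induction generalizing r with
  | _ d ih =>
    intro hr
    by_cases hr0 : r = 0
    · rw [hr0]; exact dvd_zero _
    obtain ⟨s, hs⟩ := hr
    have h1 : lead v * lead r = lead u * lead s := by rw [← lead_mul, hs, lead_mul]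
    obtain ⟨w, hw⟩ := h _ ⟨_, h1⟩
    have h2 : lead r = lead (u * w) := by
      rw [lead_mul, ← lead_lead r, hw, lead_mul, lead_lead]
    have h3 := degree_sub_lt_of_lead_eq hr0 h2
    rw [hd] at h3
    have h4 : u ∣ v * (r - u * w) := ⟨s - v * w, by rw [mul_sub, mul_sub, hs]; ring⟩
    have := ih _ h3 _ rfl h4
    rwa [dvd_sub_left (Dvd.intro w rfl)] at this

/-- If the leading forms of `u` and `v` are a regular pair, they generate the ideal of leading
forms of `(u, v)`. -/
lemma lead_mem_span_lead {u v : sectionRing D} (h : RegularPair (lead u) (lead v))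
    (hu : u ≠ 0) {z : sectionRing D} (hz : z ∈ Ideal.span {u, v}) :
    lead z ∈ Ideal.span {lead u, lead v} := by
  obtain ⟨r, s, rfl⟩ := Ideal.mem_span_pair.1 hz
  clear hz
  have hu' : lead u ≠ 0 := fun h => hu (lead_eq_zero_iff.1 h)
  induction hd : (s : (RatFunc K)[X]).degree using WellFoundedLT.induction generalizing r s with
  | _ d ih =>
    by_cases hs0 : s = 0
    · rw [hs0, zero_mul, add_zero, lead_mul]
      exact Ideal.mul_mem_left _ _ (Ideal.subset_span (Set.mem_insert _ _))
    rcases lt_trichotomy ((r * u : sectionRing D) : (RatFunc K)[X]).degree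
      ((s * v : sectionRing D) : (RatFunc K)[X]).degree with hlt | heq | hlt
    · have : lead (r * u + s * v) = lead (s * v) := coe_lead_eq_of
        (natDegree_add_eq_right_of_degree_lt hlt) (leadingCoeff_add_of_degree_lt hlt)
      rw [this, lead_mul]
      exact Ideal.mul_mem_left _ _ (Ideal.subset_span (Set.mem_insert_of_mem _ rfl))
    · have hnd := natDegree_eq_of_degree_eq heq
      by_cases hlc : ((r * u : sectionRing D) : (RatFunc K)[X]).leadingCoeff +
          ((s * v : sectionRing D) : (RatFunc K)[X]).leadingCoeff = 0
      · -- the leading forms cancel, and a Koszul relation lowers the degree of `s`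
        have h1 : lead (r * u) + lead (s * v) = 0 := Subtype.ext (by
          rw [AddMemClass.coe_add, coe_lead, coe_lead, hnd, ← map_add, hlc, monomial_zero_right]
          rfl)
        rw [lead_mul, lead_mul] at h1
        obtain ⟨w, hw⟩ := h (lead s) ⟨-lead r, by linear_combination h1⟩
        have h2 : lead s = lead (u * w) := by
          rw [lead_mul, ← lead_lead s, hw, lead_mul, lead_lead]
        have h3 := degree_sub_lt_of_lead_eq hs0 h2
        rw [hd] at h3
        have := ih _ h3 (r + v * w) (s - u * w) rfl
        rwa [show (r + v * w) * u + (s - u * w) * v = r * u + s * v by ring] at this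
      · have hdeg : ((r * u + s * v : sectionRing D) : (RatFunc K)[X]).natDegree =
            ((r * u : sectionRing D) : (RatFunc K)[X]).natDegree := by
          refine natDegree_eq_of_degree_eq ?_
          rw [AddMemClass.coe_add, degree_add_eq_of_leadingCoeff_add_ne_zero hlc, heq, max_self]
        have : lead (r * u + s * v) = lead r * lead u + lead s * lead v := by
          rw [← lead_mul, ← lead_mul]
          refine Subtype.ext ?_
          rw [AddMemClass.coe_add, coe_lead, coe_lead, coe_lead, hdeg, ← hnd, ← map_add,
            AddMemClass.coe_add, leadingCoeff_add_of_degree_eq heq hlc]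
        rw [this]
        exact Ideal.mem_span_pair.2 ⟨_, _, rfl⟩
    · have : lead (r * u + s * v) = lead (r * u) := coe_lead_eq_of
        (natDegree_add_eq_left_of_degree_lt hlt) (leadingCoeff_add_of_degree_lt' hlt)
      rw [this, lead_mul]
      exact Ideal.mul_mem_left _ _ (Ideal.subset_span (Set.mem_insert _ _))

lemma exists_coeff_mul_eq_coeff_lead_mul (u r : sectionRing D) (d : ℕ) :
    ∃ r' : sectionRing D, ((r' * u : sectionRing D) : (RatFunc K)[X]).natDegree ≤ d ∧
      ((r' * u : sectionRing D) : (RatFunc K)[X]).coeff d =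
        ((r * lead u : sectionRing D) : (RatFunc K)[X]).coeff d := by
  rw [MulMemClass.coe_mul, coe_lead]
  rcases le_or_gt (u : (RatFunc K)[X]).natDegree d with h | h
  · obtain ⟨l, rfl⟩ := Nat.exists_eq_add_of_le' h
    refine ⟨component D l r, ?_, ?_⟩
    · rw [MulMemClass.coe_mul, coe_component]
      exact natDegree_mul_le.trans (add_le_add_left (natDegree_monomial_le _) _)
    · rw [MulMemClass.coe_mul, coe_component, coeff_mul_monomial, add_comm, coeff_monomial_mul,
        leadingCoeff]
  · refine ⟨0, ?_, ?_⟩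
    · rw [zero_mul]; exact Nat.zero_le _
    · rw [zero_mul, ← C_mul_X_pow_eq_monomial, ← mul_assoc, coeff_mul_X_pow', if_neg (by omega)]
      rfl

/-- Tight closure may be tested on leading forms: `(u, v)` is tightly closed if the homogeneous
elements of the tight closure of `(lead u, lead v)`, computed with homogeneous multipliers `c`, lie
in that ideal. -/
lemma _root_.TightPair.of_lead {p : ℕ} [ExpChar (sectionRing D) p] {u v : sectionRing D}
    (hreg : RegularPair (lead u) (lead v)) (hu : u ≠ 0)
    (h : ∀ z c : sectionRing D, lead z = z → lead c = c → c ≠ 0 → ∀ e₀ : ℕ,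
      (∀ e ≥ e₀, c * z ^ p ^ e ∈ Ideal.span {lead u ^ p ^ e, lead v ^ p ^ e}) →
      z ∈ Ideal.span {lead u, lead v}) : TightPair p u v := by
  intro z c hc e₀ he
  induction hd : (z : (RatFunc K)[X]).degree using WellFoundedLT.induction generalizing z with
  | _ d ih =>
    by_cases hz0 : z = 0
    · rw [hz0]; exact zero_mem _
    have h1 : lead z ∈ Ideal.span {lead u, lead v} := by
      refine h _ (lead c) (lead_lead z) (lead_lead c) (fun h => hc (lead_eq_zero_iff.1 h)) e₀
        fun e hee => ?_
      have := lead_mem_span_lead (u := u ^ p ^ e) (v := v ^ p ^ e)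
        (by rw [lead_pow, lead_pow]; exact hreg.pow _ _) (pow_ne_zero _ hu) (he e hee)
      rwa [lead_mul, lead_pow, lead_pow, lead_pow] at this
    obtain ⟨r, s, hrs⟩ := Ideal.mem_span_pair.1 h1
    set m := (z : (RatFunc K)[X]).natDegree with hm
    obtain ⟨r', hr1, hr2⟩ := exists_coeff_mul_eq_coeff_lead_mul u r m
    obtain ⟨s', hs1, hs2⟩ := exists_coeff_mul_eq_coeff_lead_mul v s m
    have hcoeff : ((r' * u + s' * v : sectionRing D) : (RatFunc K)[X]).coeff m =
        (z : (RatFunc K)[X]).coeff m := by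
      rw [AddMemClass.coe_add, coeff_add, hr2, hs2, ← coeff_add, ← AddMemClass.coe_add, hrs,
        coe_lead, coeff_monomial_same, leadingCoeff]
    have hlt : ((z - (r' * u + s' * v) : sectionRing D) : (RatFunc K)[X]).degree <
        (z : (RatFunc K)[X]).degree := by
      rw [degree_eq_natDegree fun h => hz0 (Subtype.ext h), degree_lt_iff_coeff_zero]
      intro l hl
      rw [AddSubgroupClass.coe_sub, coeff_sub]
      rcases hl.eq_or_lt with rfl | hl
      · rw [hcoeff, sub_self]
      · rw [coeff_eq_zero_of_natDegree_lt hl, coeff_eq_zero_of_natDegree_lt, sub_zero]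
        refine (natDegree_add_le _ _).trans_lt (max_lt (hr1.trans_lt hl) (hs1.trans_lt hl))
    have hmem : z - (r' * u + s' * v) ∈ Ideal.span {u, v} := by
      refine ih _ (hd ▸ hlt) _ (fun e hee => ?_) rfl
      obtain ⟨r₁, s₁, h₁⟩ := Ideal.mem_span_pair.1 (he e hee)
      refine Ideal.mem_span_pair.2 ⟨r₁ - c * r' ^ p ^ e, s₁ - c * s' ^ p ^ e, ?_⟩
      rw [sub_pow_expChar_pow, add_pow_expChar_pow, mul_pow, mul_pow]
      linear_combination h₁
    have := add_mem hmem (Ideal.mem_span_pair.2 ⟨r', s', rfl⟩)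
    rwa [sub_add_cancel] at this

end lead

end ProjLine

namespace ProjLine

open Polynomial

variable {K : Type u} [Field K] {n k : ℕ} {α : Fin k → K}

/-! ### Tight closure of height two ideals of the section ring -/

lemma regularPair_elemY_elemH (hn : 0 < n) (hk : 0 < k) (hα : Function.Injective α) :
    RegularPair (elemY hn hα) (elemH hn hα) := by
  rintro r ⟨s, hs⟩
  have hdvd : ∀ i, elemY hn hα ∣ component _ i r := by
    intro i
    obtain ⟨f, hf, hc⟩ := exists_component_eq_sec hn hα r i
    by_cases hi : n * (i / n) = i
    · -- comparing coefficients in degree `i + n`, the numerator of `r` is divisible by `g`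
      set m := i / n
      have hY : elemY hn hα ∣ elemH hn hα * component _ i r := by
        refine ⟨component _ (i + n - 1) s, Subtype.ext ?_⟩
        have h1 : ((elemH hn hα * r : fracRing n α) : (RatFunc K)[X]).coeff (i + n) =
            ((elemY hn hα * s : fracRing n α) : (RatFunc K)[X]).coeff (i + n) := by rw [hs]
        rw [MulMemClass.coe_mul, MulMemClass.coe_mul, coe_elemH, coe_elemY,
          coeff_monomial_mul, show i + n = (i + n - 1) + 1 by omega, coeff_X_mul] at h1
        rw [MulMemClass.coe_mul, MulMemClass.coe_mul, coe_elemH, coe_elemY, coe_component,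
          coe_component, monomial_mul_monomial, X_mul_monomial, h1, add_comm n i,
          show i + n - 1 + 1 = i + n by omega]
      have hco : ((elemH hn hα * component _ i r : fracRing n α) : (RatFunc K)[X]).coeff
          (n * (m + 1)) = frac α f (m + 1) := by
        rw [hc, MulMemClass.coe_mul, coe_elemH, coe_sec, monomial_mul_monomial, frac_mul, one_mul,
          add_comm 1, mul_add, hi, mul_one, add_comm i, coeff_monomial_same]
      rcases locEq_dvd_of_elemY_dvd hn hα hY hco with h0 | ⟨-, f', hf'⟩
      · have : component (fractionalPoints n α) i r = 0 := Subtype.ext (by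
          rw [hc, coe_sec, h0, frac_zero, monomial_zero_right]; rfl)
        rw [this]
        exact dvd_zero _
      · by_cases hf0 : f = 0
        · have : component (fractionalPoints n α) i r = 0 := Subtype.ext (by
            rw [hc, coe_sec, hf0, frac_zero, monomial_zero_right]; rfl)
          rw [this]
          exact dvd_zero _
        · have hf'0 : f' ≠ 0 := by rintro rfl; exact hf0 (by rw [hf', mul_zero])
          rw [hf', (locEq_monic α).natDegree_mul' hf'0, natDegree_locEq] at hf
          obtain ⟨l, hl⟩ : ∃ l, m = l + 1 := Nat.exists_eq_succ_of_ne_zero (by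
            rintro h
            rw [h, mul_zero] at hf
            omega)
          rw [hl, mul_add] at hf hi
          refine ⟨sec hn hα (i - 1) l f' (by omega) (by omega), Subtype.ext ?_⟩
          rw [hc, coe_sec, MulMemClass.coe_mul, coe_elemY, coe_sec, X_mul_monomial, hf',
            show i / n = l + 1 from hl,
            show i - 1 + 1 = i by omega, ← frac_locEq_pow_mul α f' l 1, pow_one, add_comm 1]
    · have hlt : n * (i / n) < i := lt_of_le_of_ne (Nat.mul_div_le i n) hi
      rw [hc]
      have := elemY_pow_mul_sec hn hα 1 (i - 1) (i / n) f (by omega) hf (by omega)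
      rw [pow_one] at this
      refine ⟨sec hn hα (i - 1) (i / n) f (by omega) hf, ?_⟩
      rw [this]
      refine Subtype.ext ?_
      rw [coe_sec, coe_sec, show i - 1 + 1 = i by omega]
  rw [← sum_component _ r]
  exact Finset.dvd_sum fun i _ => hdvd i

lemma pow_sub_C_eval_pow {p : ℕ} [ExpChar K p] (f : K[X]) (a : K) (e : ℕ) :
    (X - C a) ^ p ^ e ∣ f ^ p ^ e - C (f.eval a ^ p ^ e) := by
  rw [C_pow, ← sub_pow_expChar_pow]
  refine pow_dvd_pow_of_dvd (dvd_iff_isRoot.2 ?_) _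
  simp

/-- If `Γ f ^ q ≡ S` modulo a high power of `g`, where `deg Γ, deg S` are small compared with `q`,
then all values `f(αⱼ)` agree: `f ^ q` is constant modulo `(x - αⱼ) ^ q`, so
`Γ f(αⱼ) ^ q = S` for every `j`. -/
lemma eval_eq_eval_of_mul_pow_eq {p : ℕ} [ExpChar K p] {Γ f S ρ : K[X]} {e N B : ℕ}
    (hΓ0 : Γ ≠ 0) (hΓ : Γ.natDegree ≤ B) (hS : S.natDegree ≤ B) (hN : B < N) (hq : B < p ^ e)
    (h : Γ * f ^ p ^ e = locEq α ^ N * ρ + S) (i j : Fin k) :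
    f.eval (α i) = f.eval (α j) := by
  have key : ∀ j, Γ * C (f.eval (α j) ^ p ^ e) = S := by
    intro j
    rw [← sub_eq_zero]
    refine eq_zero_of_dvd_of_natDegree_lt (p := (X - C (α j)) ^ (B + 1)) ?_ ?_
    · have h1 : Γ * C (f.eval (α j) ^ p ^ e) - S =
          locEq α ^ N * ρ - Γ * (f ^ p ^ e - C (f.eval (α j) ^ p ^ e)) := by
        linear_combination h
      rw [h1]
      refine dvd_sub (Dvd.dvd.mul_right ?_ _) (Dvd.dvd.mul_left ?_ _)
      · exact (pow_dvd_pow _ hN).trans (pow_dvd_pow_of_dvd (X_sub_C_dvd_locEq α j) _)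
      · exact (pow_dvd_pow _ hq).trans (pow_sub_C_eval_pow f _ e)
    · rw [natDegree_pow, natDegree_X_sub_C, mul_one]
      refine lt_of_le_of_lt (natDegree_sub_le _ _) (Nat.lt_succ_of_le (max_le ?_ hS))
      exact (natDegree_mul_C_le _ _).trans hΓ
  have h1 := mul_left_cancel₀ hΓ0 ((key i).trans (key j).symm)
  exact iterateFrobenius_inj K p e (C_injective h1)

lemma lead_elemY (hn : 0 < n) (hα : Function.Injective α) :
    lead (elemY hn hα) = elemY hn hα :=
  Subtype.ext (by rw [coe_lead, coe_elemY, natDegree_X, leadingCoeff_X, monomial_one_one_eq_X])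

lemma frac_one_ne_zero (m : ℕ) : frac α 1 m ≠ 0 := frac_eq_zero_iff.not.2 one_ne_zero

lemma lead_elemH (hn : 0 < n) (hα : Function.Injective α) :
    lead (elemH hn hα) = elemH hn hα :=
  Subtype.ext (by
    rw [coe_lead, coe_elemH, leadingCoeff_monomial, natDegree_monomial_eq _ (frac_one_ne_zero 1)])

/-- The ideal `(Y, h)` is tightly closed. It contains all homogeneous elements of degree other than
`0` and `n`, and `eval_eq_eval_of_mul_pow_eq` applies to the numerators of those of degree `n`. -/
theorem tightPair_elemY_elemH (p : ℕ) [Fact p.Prime] [CharP K p] (hn : 0 < n) (hk : 0 < k)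
    (hα : Function.Injective α) : TightPair p (elemY hn hα) (elemH hn hα) := by
  refine .of_lead (by rw [lead_elemY, lead_elemH]; exact regularPair_elemY_elemH hn hk hα)
    (elemY_ne_zero hn hα) fun z c hz hc hc0 e₀ he => ?_
  rw [lead_elemY, lead_elemH]
  rw [lead_elemY, lead_elemH] at he
  set D := (z : (RatFunc K)[X]).natDegree
  set d := (c : (RatFunc K)[X]).natDegree
  have hY : elemY hn hα ∈ Ideal.span {elemY hn hα, elemH hn hα} :=
    Ideal.subset_span (Set.mem_insert _ _)
  have hH : elemH hn hα ∈ Ideal.span {elemY hn hα, elemH hn hα} :=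
    Ideal.subset_span (Set.mem_insert_of_mem _ rfl)
  obtain ⟨m, hDn, W, hW, hzW⟩ : ∃ m, ∃ hDn : n * m ≤ D, ∃ W, ∃ hW : W.natDegree ≤ k * m,
      component _ D z = sec hn hα D m W hDn hW :=
    ⟨D / n, Nat.mul_div_le D n, exists_component_eq_sec hn hα z D⟩
  obtain ⟨Γ, hΓ, hcΓ⟩ := exists_component_eq_sec hn hα c d
  replace hzW := hz.symm.trans hzW
  replace hcΓ := hc.symm.trans hcΓ
  by_cases hDm : n * m = D
  swap
  · -- `z` is a multiple of `Y`
    have : z = elemY hn hα * sec hn hα (D - 1) m W (by omega) hW := by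
      refine hzW.trans (Subtype.ext ?_)
      rw [MulMemClass.coe_mul, coe_elemY, coe_sec, coe_sec, X_mul_monomial,
        show D - 1 + 1 = D by omega]
    rw [this]
    exact Ideal.mul_mem_right _ _ hY
  have hzcoe : (z : (RatFunc K)[X]) = monomial (n * m) (frac α W m) := by
    rw [hDm]; exact congrArg Subtype.val hzW
  have hccoe : (c : (RatFunc K)[X]) = monomial d (frac α Γ (d / n)) := congrArg Subtype.val hcΓ
  have hΓ0 : Γ ≠ 0 := by
    rintro rfl
    exact hc0 (Subtype.ext (by rw [hccoe, frac_zero, monomial_zero_right]; rfl))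
  have hp1 : 1 < p := (Fact.out : p.Prime).one_lt
  set B := k * (d / n) with hB
  -- an exponent `q` that is large compared with the multiplier `c`
  obtain ⟨e, hee, hq⟩ : ∃ e ≥ e₀, d + n * (B + 1) < p ^ e :=
    ⟨max e₀ (d + n * (B + 1)), le_max_left _ _, (Nat.lt_pow_self hp1).trans_le
      (Nat.pow_le_pow_right (by omega) (le_max_right _ _))⟩
  obtain ⟨r, s, hrs⟩ := Ideal.mem_span_pair.1 (he e hee)
  set q := p ^ e with hqdef
  have hBq : B < q := by
    have : B + 1 ≤ n * (B + 1) := Nat.le_mul_of_pos_left _ hn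
    omega
  have hcz : ((c * z ^ q : fracRing n α) : (RatFunc K)[X]) =
      monomial (d + n * m * q) (frac α (Γ * W ^ q) (d / n + m * q)) := by
    rw [MulMemClass.coe_mul, SubmonoidClass.coe_pow, hzcoe, hccoe, monomial_pow, frac_pow,
      monomial_mul_monomial, frac_mul]
  have hco := congrArg (fun F : fracRing n α => (F : (RatFunc K)[X]).coeff (d + n * m * q)) hrs
  rw [hcz, coeff_monomial_same, AddMemClass.coe_add, coeff_add, MulMemClass.coe_mul,
    MulMemClass.coe_mul, coe_elemY_pow, coe_elemH_pow, coeff_mul_X_pow'] at hco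
  rcases m with _ | _ | m
  · -- degree zero: `c z ^ q` has degree `d < q`
    have : Γ * W ^ q = 0 := by
      rw [← frac_eq_zero_iff (α := α), ← hco, mul_zero, zero_mul, add_zero, if_neg (by omega),
        ← C_mul_X_pow_eq_monomial, ← mul_assoc, coeff_mul_X_pow', if_neg, add_zero]
      have : q ≤ n * q := Nat.le_mul_of_pos_left _ hn
      omega
    have hW0 : W = 0 := eq_zero_of_pow_eq_zero ((mul_eq_zero.1 this).resolve_left hΓ0)
    have : z = 0 := Subtype.ext (by rw [hzcoe, hW0, frac_zero, monomial_zero_right]; rfl)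
    rw [this]
    exact zero_mem _
  · -- degree `n`
    rw [zero_add] at hW hzcoe hco
    rw [mul_one, one_mul, coeff_mul_monomial] at hco
    have hnq : q ≤ n * q := Nat.le_mul_of_pos_left _ hn
    rw [if_pos (by omega)] at hco
    obtain ⟨ρ, -, hρ⟩ := exists_coeff_eq hα r (d + n * q - q)
    obtain ⟨S, hS, hS'⟩ := exists_coeff_eq hα s d
    set m' := (d + n * q - q) / n
    have hm' : n * m' ≤ d + n * q - q := Nat.mul_div_le _ _
    have hm'q : m' ≤ q := Nat.le_of_mul_le_mul_left (hm'.trans (by omega)) hn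
    obtain ⟨N, hN⟩ : ∃ N, N + m' = d / n + q := ⟨d / n + q - m',
      Nat.sub_add_cancel (hm'q.trans (Nat.le_add_left _ _))⟩
    have hBN : B < N := by
      have h1 : n * (N + m') = n * (d / n) + n * q := by rw [hN, mul_add]
      rw [mul_add] at h1
      have h2 : n * (B + 1) ≤ n * N := by omega
      exact Nat.le_of_mul_le_mul_left h2 hn
    rw [hρ, hS', frac_mul, mul_one, ← hN, ← frac_locEq_pow_mul α ρ m' N, ← frac_add,
      frac_inj] at hco
    have heval := eval_eq_eval_of_mul_pow_eq (α := α) hΓ0 hΓ hS hBN hBq hco.symm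
    -- so `W` is a constant modulo `g`
    let τ := W.eval (α ⟨0, hk⟩)
    obtain ⟨f, hf⟩ := locEq_dvd_of_eval_eq_zero hα (f := W - C τ) fun j => by
      rw [eval_sub, eval_C, heval j ⟨0, hk⟩, sub_self]
    have hf0 : f.natDegree = 0 := by
      by_cases h0 : f = 0
      · rw [h0, natDegree_zero]
      have h1 : (W - C τ).natDegree ≤ k * 1 := by rw [natDegree_sub_C]; exact hW
      rw [hf, (locEq_monic α).natDegree_mul' h0, natDegree_locEq] at h1
      omega
    have hWe : W = C τ * 1 + C (f.coeff 0) * locEq α ^ 1 := by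
      rw [← eq_C_of_natDegree_eq_zero hf0]
      linear_combination hf
    have : z = τ • elemH hn hα + f.coeff 0 • elemY hn hα ^ n := by
      refine Subtype.ext ?_
      rw [hzcoe, AddMemClass.coe_add, SetLike.val_smul, SetLike.val_smul, coe_elemY_pow, coe_elemH,
        hWe, frac_add, frac_C_mul, frac_C_mul, frac_locEq_pow, map_add, mul_one, ← smul_monomial,
        ← smul_monomial, monomial_one_right_eq_X_pow]
    rw [this]
    exact add_mem (Submodule.smul_of_tower_mem _ _ hH)
      (Submodule.smul_of_tower_mem _ _ (Ideal.pow_mem_of_mem _ hY _ hn))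
  · -- higher degree: divide the numerator by `g`
    have hq' : (W /ₘ locEq α).natDegree ≤ k * (m + 1) := by
      rw [natDegree_divByMonic _ (locEq_monic α), natDegree_locEq]
      rw [mul_add] at hW
      omega
    have hr' : (W %ₘ locEq α).natDegree ≤ k * (m + 1) := by
      have := natDegree_modByMonic_le W (locEq_monic α)
      rw [natDegree_locEq] at this
      exact this.trans (Nat.le_mul_of_pos_right _ (Nat.succ_pos m))
    have : z = elemY hn hα ^ n * sec hn hα (n * (m + 1)) (m + 1) (W /ₘ locEq α) le_rfl hq' +
        elemH hn hα * sec hn hα (n * (m + 1)) (m + 1) (W %ₘ locEq α) le_rfl hr' := by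
      refine Subtype.ext ?_
      rw [hzcoe, AddMemClass.coe_add, MulMemClass.coe_mul, MulMemClass.coe_mul, coe_sec, coe_sec,
        coe_elemY_pow, coe_elemH, X_pow_mul_monomial, monomial_mul_monomial, frac_mul, one_mul,
        ← frac_locEq_pow_mul α (W /ₘ locEq α) (m + 1) 1, pow_one, add_comm n, ← map_add,
        add_comm 1 (m + 1), ← frac_add, add_comm (locEq α * _), modByMonic_add_div,
        mul_add n (m + 1) 1, mul_one]
    rw [this]
    exact add_mem (Ideal.mul_mem_right _ _ (Ideal.pow_mem_of_mem _ hY _ hn))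
      (Ideal.mul_mem_right _ _ hH)

/-- Monic polynomials in `Y` and in `h` generate tightly closed ideals, since their leading forms
are powers of `Y` and of `h`. -/
theorem tightPair_aeval (p : ℕ) [Fact p.Prime] [CharP K p] (hn : 0 < n) (hk : 0 < k)
    (hα : Function.Injective α) {f f' : K[X]} (hf : f.Monic) (hf' : f'.Monic) :
    RegularPair (aeval (elemY hn hα) f) (aeval (elemH hn hα) f') ∧
      aeval (elemY hn hα) f ≠ 0 ∧
      TightPair p (aeval (elemY hn hα) f) (aeval (elemH hn hα) f') := by
  have hcoe : ∀ (F : fracRing n α) (f : K[X]), ((aeval F f : fracRing n α) : (RatFunc K)[X]) =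
      (f.map (algebraMap K (RatFunc K))).comp (F : (RatFunc K)[X]) := by
    intro F f
    rw [comp, eval₂_map, ← Subalgebra.coe_val, ← aeval_algHom_apply, aeval_def]
    rfl
  have hu : lead (aeval (elemY hn hα) f) = elemY hn hα ^ f.natDegree := by
    refine Subtype.ext ?_
    rw [coe_lead, hcoe, coe_elemY, comp_X, natDegree_map, (hf.map _).leadingCoeff,
      monomial_one_right_eq_X_pow, coe_elemY_pow]
  have hv : lead (aeval (elemH hn hα) f') = elemH hn hα ^ f'.natDegree := by
    refine Subtype.ext ?_
    have hnd : (elemH hn hα : (RatFunc K)[X]).natDegree = n := by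
      rw [coe_elemH, natDegree_monomial_eq _ (frac_one_ne_zero 1)]
    rw [coe_lead, hcoe, natDegree_comp, leadingCoeff_comp (by omega), hnd, natDegree_map,
      (hf'.map _).leadingCoeff, coe_elemH, leadingCoeff_monomial, one_mul, frac_pow, one_pow,
      one_mul, coe_elemH_pow, mul_comm]
  have hYH := regularPair_elemY_elemH hn hk hα
  have hreg : RegularPair (lead (aeval (elemY hn hα) f)) (lead (aeval (elemH hn hα) f')) := by
    rw [hu, hv]
    exact hYH.pow _ _
  have hu0 : aeval (elemY hn hα) f ≠ 0 := fun h => by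
    rw [← lead_eq_zero_iff, hu] at h
    exact pow_ne_zero _ (elemY_ne_zero hn hα) h
  refine ⟨regularPair_of_lead hreg, hu0, .of_lead hreg hu0 fun z c _ _ hc e₀ he => ?_⟩
  rw [hu, hv] at he ⊢
  exact (tightPair_elemY_elemH p hn hk hα).pow hYH (elemY_ne_zero hn hα) _ _ z c hc e₀ he

/-! ### F-rationality -/

/-- An ideal of the section ring all of whose prime divisors are maximal contains monic polynomials
in `Y` and in `h`, and therefore is tightly closed if it is generated by two elements. -/
lemma tightPair_of_krullDimLE_zero (p : ℕ) [Fact p.Prime] [CharP K p] (hn : 0 < n) (hk : 0 < k)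
    (hα : Function.Injective α) (hα0 : ∀ i, α i ≠ 0) {x y : fracRing n α} (hx : x ≠ 0)
    (h : Ring.KrullDimLE 0 (fracRing n α ⧸ Ideal.span {x, y})) : TightPair p x y := by
  have := finiteType_fracRing hn hα hα0
  have hfin := (Module.finite_iff_krullDimLE_zero K (fracRing n α ⧸ Ideal.span {x, y})).2 h
  have key : ∀ F : fracRing n α, ∃ f : K[X], f.Monic ∧ aeval F f ∈ Ideal.span {x, y} := by
    intro F
    obtain ⟨f, hf, hF⟩ := Algebra.IsIntegral.isIntegral (R := K)
      (Ideal.Quotient.mkₐ K (Ideal.span {x, y}) F)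
    refine ⟨f, hf, Ideal.Quotient.eq_zero_iff_mem.1 ?_⟩
    rw [← aeval_def, aeval_algHom_apply] at hF
    exact hF
  obtain ⟨f, hf, hfmem⟩ := key (elemY hn hα)
  obtain ⟨f', hf', hfmem'⟩ := key (elemH hn hα)
  obtain ⟨hreg, hu0, htight⟩ := tightPair_aeval p hn hk hα hf hf'
  exact htight.of_regularPair hx hu0 hreg hfmem hfmem'

theorem isFRational_fracRing (p : ℕ) [Fact p.Prime] [CharP K p] (hn : 0 < n) (hk : 0 < k)
    (hα : Function.Injective α) (hα0 : ∀ i, α i ≠ 0) : IsFRational p (fracRing n α) := by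
  have hnoeth := isNoetherianRing_fracRing hn hα hα0
  have hdim := ringKrullDim_fracRing hn hk hα hα0
  have hp1 : 1 < p := (Fact.out : p.Prime).one_lt
  rintro I ⟨r, x, rfl, hpar⟩ z
  constructor
  swap
  · intro hz
    refine ⟨1, fun P hP => (Ideal.ne_top_iff_one P).1 hP.1.1.ne_top, 0, fun e _ => ?_⟩
    rw [one_mul, ← iterateFrobenius_def]
    exact Ideal.mem_map_of_mem _ hz
  rintro ⟨c, hc, e₀, he⟩
  have hc0 : c ≠ 0 := by
    rintro rfl
    obtain ⟨P, hP⟩ := Ideal.nonempty_minimalPrimes (I := (⊥ : Ideal (fracRing n α))) bot_ne_top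
    exact hc P hP (zero_mem _)
  by_cases htop : Ideal.span (Set.range x) = ⊤
  · rw [htop]; trivial
  -- the height of a prime containing the ideal is at least the number of parameters
  have hheight : ∀ P : Ideal (fracRing n α), ∀ _ : P.IsPrime, Ideal.span (Set.range x) ≤ P →
      ((r : ℕ∞) : WithBot ℕ∞) ≤ P.height := by
    intro P hP hle
    obtain ⟨s, w, hs, -⟩ := hpar P hle
    rw [IsLocalization.AtPrime.ringKrullDim_eq_height P] at hs
    rw [hs]
    exact_mod_cast Nat.le_add_right r s
  have hle2 : ∀ P : Ideal (fracRing n α), P.IsPrime → (P.height : WithBot ℕ∞) ≤ 2 := by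
    intro P hP
    rw [← hdim]
    exact Ideal.height_le_ringKrullDim_of_ne_top hP.ne_top
  obtain ⟨M, hM, hIM⟩ := Ideal.exists_le_maximal _ htop
  have hr : r ≤ 2 := by
    have : ((r : ℕ∞) : WithBot ℕ∞) ≤ ((2 : ℕ∞) : WithBot ℕ∞) :=
      (hheight M hM.isPrime hIM).trans (hle2 M hM.isPrime)
    exact_mod_cast WithBot.coe_le_coe.1 this
  have hmap : ∀ e, (Ideal.span (Set.range x)).map (iterateFrobenius (fracRing n α) p e) =
      Ideal.span (Set.range fun i => x i ^ p ^ e) := by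
    intro e
    rw [Ideal.map_span, ← Set.range_comp]
    rfl
  simp only [hmap] at he
  have hprincipal : ∀ y : fracRing n α, (∀ e, Ideal.span (Set.range fun i => x i ^ p ^ e) ≤
      Ideal.span {y ^ p ^ e}) → z ∈ Ideal.span {y} := fun y hy =>
    mem_span_singleton_of_forall_pow hp1 hc0 fun e hee => hy e (he e hee)
  interval_cases r
  · have := hprincipal 0 fun e => by rw [Set.range_eq_empty, Ideal.span_empty]; exact bot_le
    rw [Ideal.mem_span_singleton, zero_dvd_iff] at this
    rw [this]
    exact zero_mem _
  · have := hprincipal (x 0) fun e => by rw [Set.range_unique]; exact le_rfl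
    rw [Set.range_unique]
    exact this
  · have hpair : ∀ y : Fin 2 → fracRing n α, Set.range y = {y 0, y 1} := fun y => by
      ext a
      simp [eq_comm]
    rw [hpair] at htop hheight ⊢
    simp only [hpair] at he hprincipal
    by_cases hx0 : x 0 = 0
    · have := hprincipal (x 1) fun e => by
        rw [hx0, zero_pow (pow_ne_zero _ (by omega)), Ideal.span_le]
        rintro _ (rfl | rfl)
        · exact zero_mem _
        · exact Ideal.mem_span_singleton_self _
      exact Ideal.span_mono (Set.subset_insert _ _) this
    refine tightPair_of_krullDimLE_zero p hn hk hα hα0 hx0 ?_ z c hc0 e₀ he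
    rw [Ring.krullDimLE_zero_iff]
    intro Q hQ
    have hQ' : (Q.comap (Ideal.Quotient.mk (Ideal.span {x 0, x 1}))).IsPrime := inferInstance
    have hleQ : Ideal.span {x 0, x 1} ≤ Q.comap (Ideal.Quotient.mk (Ideal.span {x 0, x 1})) :=
      fun a ha => by
        rw [Ideal.mem_comap, Ideal.Quotient.eq_zero_iff_mem.2 ha]
        exact zero_mem _
    have : FiniteRingKrullDim (fracRing n α) := by
      rw [finiteRingKrullDim_iff_ne_bot_and_top, hdim]
      exact ⟨by decide, by decide⟩
    have hmax : (Q.comap (Ideal.Quotient.mk (Ideal.span {x 0, x 1}))).IsMaximal :=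
      Ideal.isMaximal_of_height_eq_ringKrullDim
        (((hle2 _ hQ').antisymm (hheight _ hQ' hleQ)).trans hdim.symm)
    rw [← Ideal.map_comap_of_surjective _ Ideal.Quotient.mk_surjective Q] at hQ ⊢
    exact (Ideal.map_eq_top_or_isMaximal_of_surjective _ Ideal.Quotient.mk_surjective
      hmax).resolve_left hQ.ne_top

end ProjLine

/-! ### Failure of deformation -/

/-- The condition on `n` and `k` with denominators cleared. -/
lemma add_lt_mul_of_inv_add_two_div_lt_one {n k : ℕ} (hn : 0 < n) (hk : 0 < k)
    (h : (1 : ℚ) / n + 2 / k < 1) : k + 2 * n < n * k := by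
  have hn' : (0 : ℚ) < n := Nat.cast_pos.2 hn
  have hk' : (0 : ℚ) < k := Nat.cast_pos.2 hk
  rw [div_add_div _ _ hn'.ne' hk'.ne', div_lt_one (mul_pos hn' hk'), one_mul,
    mul_comm _ (2 : ℚ)] at h
  exact_mod_cast h

namespace ProjLine

variable {K : Type u} [Field K] {n k : ℕ} {α : Fin k → K}

lemma elemY_mem_grading (hn : 0 < n) (hα : Function.Injective α) :
    elemY hn hα ∈ sectionRingGrading (fractionalPoints n α) 1 := fun j hj => by
  rw [coe_elemY, Polynomial.coeff_X_of_ne_one hj]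

lemma charP_quotient_elemY (p : ℕ) [CharP K p] (hn : 0 < n) (hα : Function.Injective α)
    (hα0 : ∀ i, α i ≠ 0) : CharP (fracRing n α ⧸ Ideal.span {elemY hn hα}) p := by
  have : Nontrivial (MvPolynomial (Fin k) K ⧸ MvPolynomial.crossIdeal (Fin k) K) := by
    refine Ideal.Quotient.nontrivial_iff.2 ((Ideal.ne_top_iff_one _).2 fun h => ?_)
    obtain ⟨i, -, -, h0, -⟩ := MvPolynomial.mem_crossIdeal_iff.1 h 0 (by simp)
    exact h0 rfl
  have := (quotientEquiv hn hα hα0).toEquiv.nontrivial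
  exact charP_of_injective_algebraMap (algebraMap K _).injective p

end ProjLine

theorem mainTheorem6 (p : ℕ) [Fact p.Prime] :
    (∀ (K : Type u) [Field K] [CharP K p] (n k : ℕ), 0 < n → 0 < k →
      (1 : ℚ) / n + 2 / k < 1 →
      ∀ α : Fin k → K, Function.Injective α → (∀ i, α i ≠ 0) →
      ∀ D : ProjLine.QDivisor K, D = ProjLine.fractionalPoints n α →
      -- `R = R(ℙ¹, D)` is a two-dimensional normal graded domain with `R₀ = K`
      Nonempty (GradedAlgebra (ProjLine.sectionRingGrading D)) ∧
      ProjLine.sectionRingGrading D 0 = 1 ∧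
      IsDomain (ProjLine.sectionRing D) ∧
      IsNoetherianRing (ProjLine.sectionRing D) ∧
      IsIntegrallyClosed (ProjLine.sectionRing D) ∧
      ringKrullDim (ProjLine.sectionRing D) = 2 ∧
      -- the elements `Y = T` and `A i = x / (x - α i) * T ^ n` of `R` ⊆ `K(x)[T]`
      (∃ (Y : ProjLine.sectionRing D) (A : Fin k → ProjLine.sectionRing D),
        (Y : Polynomial (RatFunc K)) = Polynomial.X ∧
        (∀ i, (A i : Polynomial (RatFunc K)) =
          Polynomial.C (RatFunc.X / (RatFunc.X - RatFunc.C (α i))) * Polynomial.X ^ n) ∧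
        Algebra.adjoin K (insert Y (Set.range A)) = ⊤ ∧
        Y ∈ ProjLine.sectionRingGrading D 1 ∧
        Y ∈ nonZeroDivisors (ProjLine.sectionRing D) ∧
        (∃ φ : (ProjLine.sectionRing D ⧸ Ideal.span {Y}) ≃ₐ[K]
            (MvPolynomial (Fin k) K ⧸
              Ideal.span {f : MvPolynomial (Fin k) K |
                ∃ i j : Fin k, i ≠ j ∧ f = MvPolynomial.X i * MvPolynomial.X j}),
          ∀ i, φ (Ideal.Quotient.mk _ (A i)) = Ideal.Quotient.mk _ (MvPolynomial.X i)) ∧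
        (∃ _ : CharP (ProjLine.sectionRing D ⧸ Ideal.span {Y}) p,
          IsFPure p (ProjLine.sectionRing D ⧸ Ideal.span {Y}))) ∧
      ¬ IsFPure p (ProjLine.sectionRing D) ∧
      IsFRational p (ProjLine.sectionRing D)) ∧
    ¬ FPurityDeformsForNormalGradedDomains.{u} p := by
  have hp : p.Prime := Fact.out
  constructor
  · rintro K _ _ n k hn hk hnk α hα hα0 D rfl
    have hchar := ProjLine.charP_quotient_elemY p hn hα hα0
    exact ⟨⟨inferInstance⟩, ProjLine.sectionRingGrading_zero hα, inferInstance,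
      ProjLine.isNoetherianRing_fracRing hn hα hα0, inferInstance,
      ProjLine.ringKrullDim_fracRing hn hk hα hα0,
      ⟨ProjLine.elemY hn hα, ProjLine.elemA hn hα, ProjLine.coe_elemY hn hα,
        ProjLine.coe_elemA hn hα, ProjLine.adjoin_elemY_elemA hn hα hα0,
        ProjLine.elemY_mem_grading hn hα,
        mem_nonZeroDivisors_of_ne_zero (ProjLine.elemY_ne_zero hn hα),
        ⟨ProjLine.quotientEquiv hn hα hα0, ProjLine.quotientEquiv_mk_elemA hn hα hα0⟩,
        ⟨hchar, MvPolynomial.isFPure_of_ringEquiv_quotient_crossIdeal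
          (ProjLine.quotientEquiv hn hα hα0).toRingEquiv⟩⟩,
      ProjLine.not_isFPure_fracRing p hn hα (add_lt_mul_of_inv_add_two_div_lt_one hn hk hnk),
      ProjLine.isFRational_fracRing p hn hk hα hα0⟩
  · intro hdef
    -- an infinite field of characteristic `p` has three distinct nonzero elements, and
    -- `1 / 4 + 2 / 3 < 1`
    let K := AlgebraicClosure (ULift.{u} (ZMod p))
    have : Infinite {a : K // a ≠ 0} := (Set.finite_singleton (0 : K)).infinite_compl.to_subtype
    let α : Fin 3 ↪ {a : K // a ≠ 0} := (Fin.valEmbedding).trans (Infinite.natEmbedding _)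
    have hα : Function.Injective fun i => (α i : K) := Subtype.val_injective.comp α.injective
    have hα0 : ∀ i, (α i : K) ≠ 0 := fun i => (α i).2
    have : CharP (ULift.{u} (ZMod p)) p := inferInstance
    have : CharP K p := inferInstance
    have hn : 0 < 4 := by omega
    have := ProjLine.charP_quotient_elemY p hn hα hα0
    have := ProjLine.isNoetherianRing_fracRing hn hα hα0
    refine ProjLine.not_isFPure_fracRing p hn hα (by omega) ?_
    exact hdef K _ (ProjLine.sectionRingGrading _) (ProjLine.sectionRingGrading_zero hα)
      (ProjLine.elemY hn hα) (mem_nonZeroDivisors_of_ne_zero (ProjLine.elemY_ne_zero hn hα))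
      ⟨1, one_pos, ProjLine.elemY_mem_grading hn hα⟩
      (MvPolynomial.isFPure_of_ringEquiv_quotient_crossIdeal
        (ProjLine.quotientEquiv hn hα hα0).toRingEquiv)
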